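/- For $\pi\in S_k$ and $\tau\in S_m$ with $k\le m$, let $t(\pi,\tau)$ be the probability that a uniformly random $k$-point subset $\{x_1<\dots<x_k\}$ of $\{1,\dots,m\}$ satisfies $\tau(x_i)\le\tau(x_j)\iff\pi(i)\le\pi(j)$ for all $i,j$. A sequence $(\tau_j)$ of permutations has property $P(k)$ if $|\tau_j|\to\infty$ (where $|\tau|$ is the length of $\tau$) and $t(\pi,\tau_j)\to 1/k!$ for every $\pi\in S_k$. Let $\mathcal Z$ be the set of Borel probability measures $\mu$ on $[0,1]^2$ with uniform marginals, i.e. $\mu(A\times[0,1])=\mu([0,1]\times A)=\lambda(A)$ for every Borel set $A\subseteq[0,1]$, where $\lambda$ is Lebesgue measure. For $\mu\in\mathcal Z$ and $\pi\in S_k$, let $t(\pi,\mu)$ be the probability that, when $k$ independent $\mu$-distributed points are listed in increasing order of their $x$-coordinates, the relative order of their $y$-coordinates is $\pi$. The measure $\mu$ is called $k$-symmetric if $t(\pi,\mu)=1/k!$ for every $\pi\in S_k$. A sequence $(\tau_j)$ of permutations converges to $\mu$ if $|\tau_j|\to\infty$ and $t(\pi,\tau_j)\to t(\pi,\mu)$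 for every permutation $\pi$. For $a\in[0,1]$, let $M(a)$ be the set of all points $(x,y)\in[0,1]^2$ such that $$x+y\in\{1-\tfrac a2,\;1+\tfrac a2,\;\tfrac a2,\;2-\tfrac a2\}\quad\text{or}\quad y-x\in\{-\tfrac a2,\;\tfrac a2,\;1-\tfrac a2,\;\tfrac a2-1\},$$ and let $\mu_a$ be the probability measure whose mass is uniformly distributed on $M(a)$, i.e. length (one-dimensional Hausdorff measure) restricted to $M(a)$ and divided by the length of $M(a)$. Then $\mu_a\in\mathcal Z$ for every $a\in[0,1]$, and there is $b\in[0,1]$ such that $\mu_b$ is $3$-symmetric, but $\mu_b$ is not the uniform (Lebesgue) measure on $[0,1]^2$ and is not $4$-symmetric. Moreover, there exist permutation sequences converging to $\mu_b$, and every such sequence satisfies $P(3)$ but not $P(4)$. -/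

import Mathlib

open Set Filter Topology MeasureTheory

/-! ### Finite permutations: densities and the properties `P(k)` -/

open Classical in
/-- The density `t(π, τ)` of `π ∈ S_k` in `τ ∈ S_m`: the probability that a uniformly random
`k`-point subset `X = {x_1 < ... < x_k}` of the `m`-point ground set induces a permutation
isomorphic to `π`. (It takes the value `0` if `k > m`.) -/
noncomputable def permDensity {k m : ℕ} (π : Equiv.Perm (Fin k)) (τ : Equiv.Perm (Fin m)) : ℝ :=
  ((Finset.univ.filter fun X : Finset (Fin m) =>
      ∃ h : X.card = k, ∀ i j : Fin k,
        τ (X.orderEmbOfFin h i) ≤ τ (X.orderEmbOfFin h j) ↔ π i ≤ π j).card : ℝ) /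
    ((Finset.univ.filter fun X : Finset (Fin m) => X.card = k).card : ℝ)

/-- Property `P(k)` of a sequence of permutations `τ j` of length `m j`. -/
def PropertyP (k : ℕ) (m : ℕ → ℕ) (τ : ∀ j, Equiv.Perm (Fin (m j))) : Prop :=
  Tendsto m atTop atTop ∧
    ∀ π : Equiv.Perm (Fin k),
      Tendsto (fun j => permDensity π (τ j)) atTop (𝓝 (1 / (k.factorial : ℝ)))

/-! ### Measures on the unit square -/

/-- The unit square `[0,1]²`. -/
def unitSquare : Set (ℝ × ℝ) := Icc 0 1 ×ˢ Icc 0 1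

/-- Borel probability measures on `[0,1]²` (regarded as measures on the plane that are
concentrated on the unit square) with uniform marginals. -/
structure HasUniformMarginals (μ : Measure (ℝ × ℝ)) : Prop where
  prob : IsProbabilityMeasure μ
  concentrated : μ unitSquareᶜ = 0
  marginal_fst : ∀ A : Set ℝ, MeasurableSet A → A ⊆ Icc 0 1 → μ (A ×ˢ Icc 0 1) = volume A
  marginal_snd : ∀ A : Set ℝ, MeasurableSet A → A ⊆ Icc 0 1 → μ (Icc 0 1 ×ˢ A) = volume A

/-- The uniform (Lebesgue) measure on `[0,1]²`. -/
noncomputable def uniformSquare : Measure (ℝ × ℝ) := volume.restrict unitSquare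

/-- The event `A_{ρ,τ}` that the relative order of the `x`-coordinates of `k` points is given by
`ρ` and the relative order of their `y`-coordinates is given by `τ`. -/
def orderEvent {k : ℕ} (ρ τ : Equiv.Perm (Fin k)) : Set (Fin k → ℝ × ℝ) :=
  {v | ∀ i j : Fin k, ((v i).1 < (v j).1 ↔ ρ i < ρ j) ∧ ((v i).2 < (v j).2 ↔ τ i < τ j)}

/-- The density `t(π, μ)`: the probability that, when `k` independent `μ`-random points are
listed by increasing `x`-coordinate, the relative order of their `y`-coordinates is `π`.
If the points land in `A_{ρ,τ}` then this relative order is `τ ρ⁻¹`; hence the event is the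
(disjoint) union of the sets `A_{ρ,πρ}`. -/
noncomputable def measureDensity {k : ℕ} (π : Equiv.Perm (Fin k)) (μ : Measure (ℝ × ℝ)) : ℝ :=
  (Measure.pi fun _ : Fin k => μ).real (⋃ ρ : Equiv.Perm (Fin k), orderEvent ρ (π * ρ))

/-- `μ` is `k`-symmetric: all `π ∈ S_k` have the same density `1/k!` in `μ`. -/
def IsSymmetricOfOrder (k : ℕ) (μ : Measure (ℝ × ℝ)) : Prop :=
  ∀ π : Equiv.Perm (Fin k), measureDensity π μ = 1 / (k.factorial : ℝ)

/-- The sequence of permutations `τ j` of length `m j` converges to `μ`. -/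
def ConvergesToMeasure (m : ℕ → ℕ) (τ : ∀ j, Equiv.Perm (Fin (m j)))
    (μ : Measure (ℝ × ℝ)) : Prop :=
  Tendsto m atTop atTop ∧
    ∀ (k : ℕ) (π : Equiv.Perm (Fin k)),
      Tendsto (fun j => permDensity π (τ j)) atTop (𝓝 (measureDensity π μ))

/-! ### The sets `M(a)` and the measures `μ_a` -/

/-- The set `M(a)`, a union of line segments in the unit square. -/
def segmentSet (a : ℝ) : Set (ℝ × ℝ) :=
  {p | p ∈ unitSquare ∧
    (p.1 + p.2 ∈ ({1 - a / 2, 1 + a / 2, a / 2, 2 - a / 2} : Set ℝ) ∨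
      p.2 - p.1 ∈ ({-(a / 2), a / 2, 1 - a / 2, a / 2 - 1} : Set ℝ))}

/-- Length in the plane: the one-dimensional Hausdorff measure for the Euclidean distance,
transported to `ℝ × ℝ` (whose own distance in Mathlib is the maximum distance). -/
noncomputable def planeLength : Measure (ℝ × ℝ) :=
  (Measure.hausdorffMeasure 1 : Measure (EuclideanSpace ℝ (Fin 2))).map fun p => (p 0, p 1)

/-- The measure `μ_a`, whose mass is uniformly distributed on `M(a)`: length restricted to `M(a)`
and divided by the total length of `M(a)`. -/
noncomputable def segmentMeasure (a : ℝ) : Measure (ℝ × ℝ) :=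
  (planeLength (segmentSet a))⁻¹ • planeLength.restrict (segmentSet a)

/-! ### Order patterns of tuples of points -/

/-! Modulo 1, the set M(a) consists of the four geodesics y = ±x ± a/2 on the torus (coinciding in
pairs for a = 0 and a = 1), and `segmentMeasure a` is the average of the push-forwards of Lebesgue
measure to them (`segmentMeasure_eq`). Each geodesic is a graph over [0,1), so the first marginal is
uniform; invariance under swapping the coordinates gives the second.

3-symmetry is a single equation. The swap and the reflection x ↦ 1 - x preserve the measure, so
among the six patterns of length 3 only two densities can differ, that of 123, 321 and that of the
other four. Let F(z) = `cornerMass μ z`. The probability ∫ F² dμ that two points fall south-west of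
a third equals (t(123) + t(213))/3, so 3-symmetry holds once ∫ F² dμ = 1/9. This quantity is
continuous in a: the curves carrying the measures converge almost everywhere, and order relations of
points with distinct coordinates are stable. It exceeds 1/9 at a = 0 and is below 1/9 at a = 1, so
the intermediate value theorem provides b.

4-symmetry forces the uniform measure (`eq_uniformSquare_of_isSymmetricOfOrder`). Four-point events
give ∫ F² dμ = ∫ F·xy dμ = ∫ F² dxdy = 1/9, and Fubini gives ∫ F·xy dxdy = (1/3 + Q)/4 with Q = ∫
(xy)² dμ. Hence ∫ (F - xy)² is Q - 1/9 against μ and -(Q - 1/9)/2 against Lebesgue measure. Both are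
nonnegative, so both vanish, and F = xy by continuity. Since μ_b lives on a Lebesgue-null set, it is
not uniform and hence not 4-symmetric.

A sequence converging to μ_b is read off from equally spaced samples of a curve with law μ_b
(`exists_convergesToMeasure`). For any convergent sequence, P(k) is equivalent to k-symmetry of the
limit by uniqueness of limits. -/

theorem exists_perm_lt_iff_lt {k : ℕ} {f : Fin k → ℝ} (hf : Function.Injective f) :
    ∃ ρ : Equiv.Perm (Fin k), ∀ i j, f i < f j ↔ ρ i < ρ j := by
  refine ⟨(Tuple.sort f)⁻¹, fun i j => ?_⟩
  have hm : StrictMono (f ∘ Tuple.sort f) :=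
    (Tuple.monotone_sort f).strictMono_of_injective (hf.comp (Tuple.sort f).injective)
  rw [← hm.lt_iff_lt]
  simp

/-- The quotient `σ * ρ⁻¹` is an order automorphism of a finite chain, hence trivial. -/
theorem perm_eq_of_lt_iff_lt {k : ℕ} {ρ σ : Equiv.Perm (Fin k)}
    (h : ∀ i j, ρ i < ρ j ↔ σ i < σ j) : ρ = σ := by
  have hm : StrictMono (σ * ρ⁻¹ : Equiv.Perm (Fin k)) := fun i j hij => by
    have := (h (ρ⁻¹ i) (ρ⁻¹ j)).1 (by simpa using hij)
    simpa using this
  have h1 : (hm.orderIsoOfSurjective _ (Equiv.surjective _)) = OrderIso.refl (Fin k) :=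
    Subsingleton.elim _ _
  ext i
  have h2 := congrArg (fun e : Fin k ≃o Fin k => e (ρ i)) h1
  simp at h2
  rw [h2]

theorem orderEvent_eq_of_mem {k : ℕ} {ρ σ ρ' σ' : Equiv.Perm (Fin k)} {v : Fin k → ℝ × ℝ}
    (h : v ∈ orderEvent ρ σ) (h' : v ∈ orderEvent ρ' σ') : ρ = ρ' ∧ σ = σ' :=
  ⟨perm_eq_of_lt_iff_lt fun i j => (h i j).1.symm.trans (h' i j).1,
    perm_eq_of_lt_iff_lt fun i j => (h i j).2.symm.trans (h' i j).2⟩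

theorem measurableSet_orderEvent {k : ℕ} (ρ σ : Equiv.Perm (Fin k)) :
    MeasurableSet (orderEvent ρ σ) := by
  have h1 (i j : Fin k) : MeasurableSet {v : Fin k → ℝ × ℝ | (v i).1 < (v j).1} :=
    measurableSet_lt (by fun_prop) (by fun_prop)
  have h2 (i j : Fin k) : MeasurableSet {v : Fin k → ℝ × ℝ | (v i).2 < (v j).2} :=
    measurableSet_lt (by fun_prop) (by fun_prop)
  unfold orderEvent
  simp only [ofPred_forall, ofPred_and]
  exact MeasurableSet.iInter fun i => MeasurableSet.iInter fun j =>
    ((h1 i j).iff (MeasurableSet.const _)).inter ((h2 i j).iff (MeasurableSet.const _))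

/-- The event that the points have relative order `π` when listed by increasing abscissa. -/
def patternEvent {k : ℕ} (π : Equiv.Perm (Fin k)) : Set (Fin k → ℝ × ℝ) :=
  ⋃ ρ : Equiv.Perm (Fin k), orderEvent ρ (π * ρ)

theorem measurableSet_patternEvent {k : ℕ} (π : Equiv.Perm (Fin k)) :
    MeasurableSet (patternEvent π) :=
  MeasurableSet.iUnion fun _ => measurableSet_orderEvent _ _

/-- The points have pairwise distinct abscissas and pairwise distinct ordinates. -/
def DistinctCoords {k : ℕ} (v : Fin k → ℝ × ℝ) : Prop :=
  Function.Injective (fun i => (v i).1) ∧ Function.Injective (fun i => (v i).2)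

theorem DistinctCoords.exists_mem_orderEvent {k : ℕ} {v : Fin k → ℝ × ℝ} (h : DistinctCoords v) :
    ∃ ρ σ : Equiv.Perm (Fin k), v ∈ orderEvent ρ σ := by
  obtain ⟨ρ, hρ⟩ := exists_perm_lt_iff_lt h.1
  obtain ⟨σ, hσ⟩ := exists_perm_lt_iff_lt h.2
  exact ⟨ρ, σ, fun i j => ⟨hρ i j, hσ i j⟩⟩

/-! ### Measures with uniform marginals -/

namespace HasUniformMarginals

variable {μ : Measure (ℝ × ℝ)}

/-- Concentration on the square makes the strip over A and the full preimage of A agree almost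
everywhere. -/
theorem map_fst (h : HasUniformMarginals μ) : μ.map Prod.fst = volume.restrict (Icc 0 1) := by
  ext A hA
  rw [Measure.map_apply measurable_fst hA, Measure.restrict_apply hA,
    ← h.marginal_fst _ (hA.inter measurableSet_Icc) inter_subset_right]
  refine measure_congr ?_
  filter_upwards [mem_ae_iff.2 h.concentrated] with p hp
  have hp : p ∈ unitSquare := hp
  simp only [unitSquare, mem_prod] at hp
  exact propext ⟨fun h => ⟨⟨h, hp.1⟩, hp.2⟩, fun h => h.1.1⟩

theorem map_snd (h : HasUniformMarginals μ) : μ.map Prod.snd = volume.restrict (Icc 0 1) := by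
  ext A hA
  rw [Measure.map_apply measurable_snd hA, Measure.restrict_apply hA,
    ← h.marginal_snd _ (hA.inter measurableSet_Icc) inter_subset_right]
  refine measure_congr ?_
  filter_upwards [mem_ae_iff.2 h.concentrated] with p hp
  have hp : p ∈ unitSquare := hp
  simp only [unitSquare, mem_prod] at hp
  exact propext ⟨fun h => ⟨hp.1, h, hp.2⟩, fun h => h.2.1⟩

theorem of_map_eq [IsProbabilityMeasure μ] (h1 : μ.map Prod.fst = volume.restrict (Icc 0 1))
    (h2 : μ.map Prod.snd = volume.restrict (Icc 0 1)) : HasUniformMarginals μ := by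
  have e1 : ∀ᵐ p ∂μ, p.1 ∈ Icc (0 : ℝ) 1 := by
    have : ∀ᵐ x ∂(μ.map Prod.fst), x ∈ Icc (0 : ℝ) 1 := h1 ▸ ae_restrict_mem measurableSet_Icc
    exact ae_of_ae_map measurable_fst.aemeasurable this
  have e2 : ∀ᵐ p ∂μ, p.2 ∈ Icc (0 : ℝ) 1 := by
    have : ∀ᵐ x ∂(μ.map Prod.snd), x ∈ Icc (0 : ℝ) 1 := h2 ▸ ae_restrict_mem measurableSet_Icc
    exact ae_of_ae_map measurable_snd.aemeasurable this
  refine ⟨inferInstance, ?_, fun A hA hA1 => ?_, fun A hA hA1 => ?_⟩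
  · have : ∀ᵐ p ∂μ, p ∈ unitSquare := by
      filter_upwards [e1, e2] with p h1 h2 using ⟨h1, h2⟩
    exact this
  · rw [show volume A = (volume.restrict (Icc (0 : ℝ) 1)) A by
      rw [Measure.restrict_apply hA, inter_eq_left.2 hA1], ← h1, Measure.map_apply measurable_fst hA]
    refine measure_congr ?_
    filter_upwards [e2] with p hp
    exact propext ⟨fun h => h.1, fun h => ⟨h, hp⟩⟩
  · rw [show volume A = (volume.restrict (Icc (0 : ℝ) 1)) A by
      rw [Measure.restrict_apply hA, inter_eq_left.2 hA1], ← h2, Measure.map_apply measurable_snd hA]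
    refine measure_congr ?_
    filter_upwards [e1] with p hp
    exact propext ⟨fun h => h.2, fun h => ⟨hp, h⟩⟩

end HasUniformMarginals

/-- Two distinct sample points are independent, so the pair of values has law a product of two
atomless measures; the diagonal is null for it by Fubini. -/
theorem ae_pi_apply_ne {α : Type*} [MeasurableSpace α] {μ : Measure α} [IsProbabilityMeasure μ]
    {f : α → ℝ} (hf : Measurable f) (h0 : ∀ x, μ {p | f p = x} = 0) {k : ℕ} {i j : Fin k}
    (hij : i ≠ j) : ∀ᵐ v ∂Measure.pi (fun _ : Fin k => μ), f (v i) ≠ f (v j) := by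
  have hind := (ProbabilityTheory.iIndepFun_pi (μ := fun _ : Fin k => μ) (X := fun _ => f)
    (fun _ => hf.aemeasurable)).indepFun hij
  have hfm (l : Fin k) : Measurable fun v : Fin k → α => f (v l) := hf.comp (measurable_pi_apply l)
  have hmap := hind.map_prod_eq_prod_map_map (hfm i).aemeasurable (hfm j).aemeasurable
  have hev (l : Fin k) : (Measure.pi fun _ : Fin k => μ).map (fun v => f (v l)) = μ.map f := by
    have := (measurePreserving_eval (fun _ : Fin k => μ) l).map_eq
    rw [← this, Measure.map_map hf (measurable_pi_apply l)]
    simp only [this]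
    rfl
  rw [hev, hev] at hmap
  have : ∀ᵐ q ∂((μ.map f).prod (μ.map f)), q.1 ≠ q.2 := by
    have hm : MeasurableSet {q : ℝ × ℝ | q.1 = q.2} :=
      measurableSet_eq_fun measurable_fst measurable_snd
    rw [ae_iff]
    simp only [ne_eq, not_not]
    rw [Measure.measure_prod_null hm]
    filter_upwards with x
    have : Prod.mk x ⁻¹' {q : ℝ × ℝ | q.1 = q.2} = {x} := by
      ext y; simp [eq_comm]
    rw [this, Measure.map_apply hf (measurableSet_singleton x)]
    exact h0 x
  rw [← hmap] at this
  exact ae_of_ae_map (p := fun q : ℝ × ℝ => q.1 ≠ q.2) ((hfm i).prodMk (hfm j)).aemeasurable this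

theorem HasUniformMarginals.ae_distinctCoords {μ : Measure (ℝ × ℝ)} (h : HasUniformMarginals μ)
    (k : ℕ) : ∀ᵐ v ∂Measure.pi (fun _ : Fin k => μ), DistinctCoords v := by
  have := h.prob
  have h1 (x : ℝ) : μ {p | p.1 = x} = 0 := by
    have : (μ.map Prod.fst) {x} = 0 := by rw [h.map_fst]; exact measure_singleton x
    rwa [Measure.map_apply measurable_fst (measurableSet_singleton x)] at this
  have h2 (x : ℝ) : μ {p | p.2 = x} = 0 := by
    have : (μ.map Prod.snd) {x} = 0 := by rw [h.map_snd]; exact measure_singleton x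
    rwa [Measure.map_apply measurable_snd (measurableSet_singleton x)] at this
  have a1 : ∀ᵐ v ∂Measure.pi (fun _ : Fin k => μ), ∀ i j, i ≠ j → (v i).1 ≠ (v j).1 := by
    rw [ae_all_iff]; intro i; rw [ae_all_iff]; intro j
    by_cases hij : i = j
    · simp [hij]
    · filter_upwards [ae_pi_apply_ne measurable_fst h1 hij] with v hv _ using hv
  have a2 : ∀ᵐ v ∂Measure.pi (fun _ : Fin k => μ), ∀ i j, i ≠ j → (v i).2 ≠ (v j).2 := by
    rw [ae_all_iff]; intro i; rw [ae_all_iff]; intro j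
    by_cases hij : i = j
    · simp [hij]
    · filter_upwards [ae_pi_apply_ne measurable_snd h2 hij] with v hv _ using hv
  filter_upwards [a1, a2] with v hv1 hv2
  exact ⟨fun i j h => not_imp_not.1 (hv1 i j) h, fun i j h => not_imp_not.1 (hv2 i j) h⟩

/-! ### Pattern densities of a measure -/

theorem measurePreserving_comp_perm {α : Type*} [MeasurableSpace α] (μ : Measure α) [SigmaFinite μ]
    {k : ℕ} (θ : Equiv.Perm (Fin k)) :
    MeasurePreserving (fun v : Fin k → α => v ∘ θ) (Measure.pi fun _ => μ)
      (Measure.pi fun _ => μ) := by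
  have := measurePreserving_piCongrLeft (α := fun _ : Fin k => α) (fun _ => μ) θ⁻¹
  convert this using 1
  ext v i
  have := MeasurableEquiv.piCongrLeft_apply_apply (β := fun _ : Fin k => α) θ⁻¹ v (θ i)
  simpa using this.symm

/-- Relabelling the points of an i.i.d. sample does not change its law. Hence the k! events making
up a pattern density are equally likely. -/
theorem real_orderEvent_mul {μ : Measure (ℝ × ℝ)} [IsProbabilityMeasure μ] {k : ℕ}
    (ρ σ θ : Equiv.Perm (Fin k)) :
    (Measure.pi fun _ : Fin k => μ).real (orderEvent (ρ * θ) (σ * θ)) =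
      (Measure.pi fun _ : Fin k => μ).real (orderEvent ρ σ) := by
  have hp := measurePreserving_comp_perm μ θ
  rw [← hp.measureReal_preimage (measurableSet_orderEvent _ _).nullMeasurableSet]
  congr 1
  ext v
  constructor
  · intro h i j
    simpa using h (θ⁻¹ i) (θ⁻¹ j)
  · intro h i j
    simpa using h (θ i) (θ j)

theorem measureDensity_eq {μ : Measure (ℝ × ℝ)} [IsProbabilityMeasure μ] {k : ℕ}
    (π ρ : Equiv.Perm (Fin k)) :
    measureDensity π μ =
      k.factorial * (Measure.pi fun _ : Fin k => μ).real (orderEvent ρ (π * ρ)) := by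
  unfold measureDensity
  rw [measureReal_iUnion_fintype ?_ (fun _ => measurableSet_orderEvent _ _)]
  · have (θ : Equiv.Perm (Fin k)) : (Measure.pi fun _ : Fin k => μ).real (orderEvent θ (π * θ)) =
        (Measure.pi fun _ : Fin k => μ).real (orderEvent ρ (π * ρ)) := by
      rw [← real_orderEvent_mul ρ (π * ρ) (ρ⁻¹ * θ)]
      simp [mul_assoc]
    simp [this, Fintype.card_perm]
  · intro ρ ρ' hne
    exact disjoint_left.2 fun v h h' => hne (orderEvent_eq_of_mem h h').1

theorem real_orderEvent_eq {μ : Measure (ℝ × ℝ)} [IsProbabilityMeasure μ] {k : ℕ}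
    (ρ σ : Equiv.Perm (Fin k)) :
    (Measure.pi fun _ : Fin k => μ).real (orderEvent ρ σ) =
      measureDensity (σ * ρ⁻¹) μ / k.factorial := by
  rw [measureDensity_eq (σ * ρ⁻¹) ρ]
  have : (k.factorial : ℝ) ≠ 0 := by positivity
  field_simp
  simp

/-- The probability of an event that is determined by the relative orders of both coordinates. -/
theorem HasUniformMarginals.real_eq_sum {μ : Measure (ℝ × ℝ)} (h : HasUniformMarginals μ) {k : ℕ}
    {E : Set (Fin k → ℝ × ℝ)} (R : Equiv.Perm (Fin k) → Equiv.Perm (Fin k) → Prop)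
    [∀ ρ σ, Decidable (R ρ σ)]
    (hE : ∀ ρ σ, ∀ v ∈ orderEvent ρ σ, (v ∈ E ↔ R ρ σ)) :
    (Measure.pi fun _ : Fin k => μ).real E =
      ∑ ρ, ∑ σ, if R ρ σ then measureDensity (σ * ρ⁻¹) μ / k.factorial else 0 := by
  have := h.prob
  have hEae : E =ᵐ[Measure.pi fun _ : Fin k => μ]
      ⋃ q : {q : Equiv.Perm (Fin k) × Equiv.Perm (Fin k) // R q.1 q.2},
        orderEvent q.1.1 q.1.2 := by
    filter_upwards [h.ae_distinctCoords k] with v hv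
    obtain ⟨ρ, σ, hv⟩ := hv.exists_mem_orderEvent
    refine propext ⟨fun hvE => mem_iUnion.2 ⟨⟨(ρ, σ), (hE ρ σ v hv).1 hvE⟩, hv⟩, fun hvU => ?_⟩
    obtain ⟨⟨⟨ρ', σ'⟩, hR⟩, hv'⟩ := mem_iUnion.1 hvU
    exact (hE ρ' σ' v hv').2 hR
  rw [measureReal_congr hEae, measureReal_iUnion_fintype]
  · simp_rw [real_orderEvent_eq]
    rw [← Fintype.sum_prod_type'
      (f := fun ρ σ => if R ρ σ then measureDensity (σ * ρ⁻¹) μ / k.factorial else 0)]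
    rw [← Finset.sum_filter]
    exact (Finset.sum_subtype _ (fun q => by simp)
      (fun q : Equiv.Perm (Fin k) × Equiv.Perm (Fin k) =>
        measureDensity (q.2 * q.1⁻¹) μ / k.factorial)).symm
  · intro q q' hne
    exact disjoint_left.2 fun v hv hv' => hne (Subtype.ext
      (Prod.ext (orderEvent_eq_of_mem hv hv').1 (orderEvent_eq_of_mem hv hv').2))
  · exact fun _ => measurableSet_orderEvent _ _

theorem HasUniformMarginals.sum_measureDensity {μ : Measure (ℝ × ℝ)} (h : HasUniformMarginals μ)
    (k : ℕ) : ∑ π : Equiv.Perm (Fin k), measureDensity π μ = 1 := by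
  have := h.prob
  have h1 := h.real_eq_sum (k := k) (E := univ) (fun _ _ => True) (by simp)
  simp only [if_true, probReal_univ] at h1
  have (ρ : Equiv.Perm (Fin k)) :
      ∑ σ : Equiv.Perm (Fin k), measureDensity (σ * ρ⁻¹) μ / (k.factorial : ℝ) =
        (∑ π : Equiv.Perm (Fin k), measureDensity π μ) / k.factorial := by
    rw [Finset.sum_div]
    exact Fintype.sum_equiv (Equiv.mulRight ρ⁻¹) _ _ (fun _ => rfl)
  have h0 : (k.factorial : ℝ) ≠ 0 := by positivity
  simp only [this, Finset.sum_const, Finset.card_univ, Fintype.card_perm, Fintype.card_fin,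
    nsmul_eq_mul] at h1
  rw [h1, mul_div_cancel₀ _ h0]

/-! ### Dependence of pattern probabilities on the measure -/

/-- Membership in `E` depends only on the relative orders of the coordinates. -/
def IsOrderInvariant {k : ℕ} (E : Set (Fin k → ℝ × ℝ)) : Prop :=
  ∀ v w : Fin k → ℝ × ℝ, (∀ i j, ((v i).1 < (v j).1 ↔ (w i).1 < (w j).1) ∧
    ((v i).2 < (v j).2 ↔ (w i).2 < (w j).2)) → v ∈ E → w ∈ E

theorem isOrderInvariant_patternEvent {k : ℕ} (π : Equiv.Perm (Fin k)) :
    IsOrderInvariant (patternEvent π) := by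
  intro v w h hv
  obtain ⟨ρ, hρ⟩ := mem_iUnion.1 hv
  exact mem_iUnion.2 ⟨ρ, fun i j => ⟨(h i j).1.symm.trans (hρ i j).1,
    (h i j).2.symm.trans (hρ i j).2⟩⟩

theorem eventually_lt_iff_lt {ι : Type*} {l : Filter ι} {a b : ℝ} {f g : ι → ℝ}
    (hf : Tendsto f l (𝓝 a)) (hg : Tendsto g l (𝓝 b)) (hab : a ≠ b) :
    ∀ᶠ n in l, (f n < g n ↔ a < b) := by
  rcases lt_or_gt_of_ne hab with h | h
  · filter_upwards [hf.eventually_lt hg h] with n hn using ⟨fun _ => h, fun _ => hn⟩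
  · filter_upwards [hg.eventually_lt hf h] with n hn
    exact ⟨fun h' => absurd h' hn.not_gt, fun h' => absurd h' h.not_gt⟩

/-- If maps converge almost everywhere to a map whose law has uniform marginals, then the
probabilities of order invariant events converge. -/
theorem tendsto_real_of_isOrderInvariant {Ω ι : Type*} [MeasurableSpace Ω] {P : Measure Ω}
    [IsProbabilityMeasure P] {l : Filter ι} [l.IsCountablyGenerated]
    {G : Ω → ℝ × ℝ} {Gn : ι → Ω → ℝ × ℝ} (hG : Measurable G) (hGn : ∀ n, Measurable (Gn n))
    (hlim : ∀ᵐ u ∂P, Tendsto (fun n => Gn n u) l (𝓝 (G u)))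
    (hU : HasUniformMarginals (P.map G)) {k : ℕ} {E : Set (Fin k → ℝ × ℝ)}
    (hEm : MeasurableSet E) (hE : IsOrderInvariant E) :
    Tendsto (fun n => (Measure.pi fun _ : Fin k => P.map (Gn n)).real E) l
      (𝓝 ((Measure.pi fun _ : Fin k => P.map G).real E)) := by
  have hmap {H : Ω → ℝ × ℝ} (hH : Measurable H) :
      (Measure.pi fun _ : Fin k => P.map H).real E =
        (Measure.pi fun _ : Fin k => P).real ((fun w i => H (w i)) ⁻¹' E) := by
    have : IsProbabilityMeasure (P.map H) := Measure.isProbabilityMeasure_map hH.aemeasurable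
    rw [← Measure.pi_map_pi (fun _ => hH.aemeasurable), map_measureReal_apply (by fun_prop) hEm]
  simp_rw [hmap hG, hmap (hGn _)]
  have hpre {H : Ω → ℝ × ℝ} (hH : Measurable H) :
      MeasurableSet ((fun (w : Fin k → Ω) i => H (w i)) ⁻¹' E) :=
    hEm.preimage (by fun_prop)
  simp_rw [← integral_indicator_one (hpre hG), ← integral_indicator_one (hpre (hGn _))]
  refine tendsto_integral_filter_of_dominated_convergence (fun _ => (1 : ℝ)) ?_ ?_ ?_ ?_
  · exact Eventually.of_forall fun n =>
      ((measurable_one.indicator (hpre (hGn n))).aestronglyMeasurable)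
  · refine Eventually.of_forall fun n => Eventually.of_forall fun w => ?_
    by_cases h : w ∈ ((fun (w : Fin k → Ω) i => Gn n (w i)) ⁻¹' E) <;> simp [indicator, h]
  · exact integrable_const _
  -- Almost surely the limit points have distinct coordinates, so every strict comparison is
  -- eventually decided as in the limit and the indicator of `E` is eventually constant. Only the
  -- limit law needs atomless marginals.
  · have hd : ∀ᵐ w ∂Measure.pi (fun _ : Fin k => P), DistinctCoords (fun i => G (w i)) := by
      have := hU.ae_distinctCoords k
      rw [← Measure.pi_map_pi (fun _ => hG.aemeasurable)] at this
      exact ae_of_ae_map (measurable_pi_lambda _ fun i =>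
        hG.comp (measurable_pi_apply i)).aemeasurable this
    have hl : ∀ᵐ w ∂Measure.pi (fun _ : Fin k => P),
        ∀ i, Tendsto (fun n => Gn n (w i)) l (𝓝 (G (w i))) := by
      rw [ae_all_iff]
      intro i
      exact (measurePreserving_eval (fun _ : Fin k => P) i).quasiMeasurePreserving.ae hlim
    filter_upwards [hd, hl] with w hwd hwl
    have hev : ∀ᶠ n in l, ∀ i j, ((Gn n (w i)).1 < (Gn n (w j)).1 ↔ (G (w i)).1 < (G (w j)).1) ∧
        ((Gn n (w i)).2 < (Gn n (w j)).2 ↔ (G (w i)).2 < (G (w j)).2) := by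
      rw [eventually_all]; intro i; rw [eventually_all]; intro j
      by_cases hij : i = j
      · simp [hij]
      · exact (eventually_lt_iff_lt ((continuous_fst.tendsto _).comp (hwl i))
          ((continuous_fst.tendsto _).comp (hwl j)) (hwd.1.ne hij)).and
          (eventually_lt_iff_lt ((continuous_snd.tendsto _).comp (hwl i))
          ((continuous_snd.tendsto _).comp (hwl j)) (hwd.2.ne hij))
    refine tendsto_const_nhds.congr' ?_
    filter_upwards [hev] with n hn
    have : (fun i => G (w i)) ∈ E ↔ (fun i => Gn n (w i)) ∈ E :=
      ⟨hE _ _ fun i j => ⟨(hn i j).1.symm, (hn i j).2.symm⟩, hE _ _ hn⟩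
    by_cases hw : (fun i => G (w i)) ∈ E
    · rw [indicator_of_mem (by exact hw), indicator_of_mem (by exact this.1 hw)]
    · rw [indicator_of_notMem (by exact hw), indicator_of_notMem (by exact fun h => hw (this.2 h))]

/-! ### Four-symmetric measures are uniform -/

theorem integrable_of_ae_abs_le {α : Type*} [MeasurableSpace α] {μ : Measure α} [IsFiniteMeasure μ]
    {f : α → ℝ} (hf : Measurable f) {C : ℝ} (h : ∀ᵐ x ∂μ, |f x| ≤ C) : Integrable f μ :=
  Integrable.of_bound hf.aestronglyMeasurable C h

/-- Fubini: conditioning on the first sample point. -/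
theorem real_pi_fin_succ {α : Type*} [MeasurableSpace α] {μ : Measure α} [IsProbabilityMeasure μ]
    {n : ℕ} {E : Set (Fin (n + 1) → α)} (hE : MeasurableSet E) :
    (Measure.pi fun _ : Fin (n + 1) => μ).real E =
      ∫ z, (Measure.pi fun _ : Fin n => μ).real {w | (Fin.cons z w : Fin (n + 1) → α) ∈ E} ∂μ := by
  have hp := (measurePreserving_piFinSuccAbove (fun _ : Fin (n + 1) => μ) 0).symm
  rw [← hp.measureReal_preimage hE.nullMeasurableSet, measureReal_def,
    Measure.prod_apply (hp.measurable hE), ← integral_toReal]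
  · congr 1
    ext z
    rw [measureReal_def]
    congr 2
    ext w
    simp [MeasurableEquiv.piFinSuccAbove, Fin.insertNthEquiv]
  · exact (measurable_measure_prodMk_left (hp.measurable hE)).aemeasurable
  · exact ae_of_all _ fun z => measure_lt_top _ _

theorem real_pi_univ_pi {α : Type*} [MeasurableSpace α] {μ : Measure α} [IsProbabilityMeasure μ]
    {n : ℕ} (A : Fin n → Set α) :
    (Measure.pi fun _ : Fin n => μ).real {w | ∀ i, w i ∈ A i} = ∏ i, μ.real (A i) := by
  have : {w : Fin n → α | ∀ i, w i ∈ A i} = Set.pi univ A := by ext; simp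
  rw [this, measureReal_def, Measure.pi_pi, ENNReal.toReal_prod]
  rfl

/-- The mass of the quadrant to the south-west of `z`. -/
noncomputable def cornerMass (μ : Measure (ℝ × ℝ)) (z : ℝ × ℝ) : ℝ :=
  μ.real (Iio z.1 ×ˢ Iio z.2)

section

variable {μ : Measure (ℝ × ℝ)}

theorem measurable_cornerMass [IsProbabilityMeasure μ] : Measurable (cornerMass μ) := by
  have hm : MeasurableSet {q : (ℝ × ℝ) × (ℝ × ℝ) | q.2.1 < q.1.1 ∧ q.2.2 < q.1.2} := by
    rw [ofPred_and]
    exact (measurableSet_lt (by fun_prop) (by fun_prop)).inter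
      (measurableSet_lt (by fun_prop) (by fun_prop))
  exact (measurable_measure_prodMk_left hm).ennreal_toReal

theorem cornerMass_nonneg (z : ℝ × ℝ) : 0 ≤ cornerMass μ z := measureReal_nonneg

theorem cornerMass_le_one [IsProbabilityMeasure μ] (z : ℝ × ℝ) : cornerMass μ z ≤ 1 :=
  measureReal_le_one

theorem abs_cornerMass_le_one [IsProbabilityMeasure μ] (z : ℝ × ℝ) : |cornerMass μ z| ≤ 1 := by
  rw [abs_of_nonneg (cornerMass_nonneg z)]
  exact cornerMass_le_one z

theorem real_iio_restrict_Icc {x : ℝ} (hx : x ∈ Icc (0 : ℝ) 1) :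
    (volume.restrict (Icc (0 : ℝ) 1)).real (Iio x) = x := by
  rw [measureReal_restrict_apply measurableSet_Iio,
    show Iio x ∩ Icc 0 1 = Ico 0 x by
      ext y; simp only [mem_inter_iff, mem_Iio, mem_Icc, mem_Ico]
      exact ⟨fun h => ⟨h.2.1, h.1⟩, fun h => ⟨h.2, h.1, h.2.le.trans hx.2⟩⟩]
  simp [hx.1]

namespace HasUniformMarginals

theorem ae_mem (h : HasUniformMarginals μ) : ∀ᵐ p ∂μ, p.1 ∈ Icc (0 : ℝ) 1 ∧ p.2 ∈ Icc (0 : ℝ) 1 := by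
  have : ∀ᵐ p ∂μ, p ∈ unitSquare := h.concentrated
  exact this

theorem real_fst_lt (h : HasUniformMarginals μ) {x : ℝ} (hx : x ∈ Icc (0 : ℝ) 1) :
    μ.real {p | p.1 < x} = x := by
  have := h.prob
  have h1 := real_iio_restrict_Icc hx
  rw [← h.map_fst, map_measureReal_apply measurable_fst measurableSet_Iio] at h1
  exact h1

theorem real_snd_lt (h : HasUniformMarginals μ) {x : ℝ} (hx : x ∈ Icc (0 : ℝ) 1) :
    μ.real {p | p.2 < x} = x := by
  have := h.prob
  have h1 := real_iio_restrict_Icc hx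
  rw [← h.map_snd, map_measureReal_apply measurable_snd measurableSet_Iio] at h1
  exact h1

/-- In a `k`-symmetric measure the two coordinates have independent uniform relative orders. -/
theorem real_eq_of_isSymmetricOfOrder (h : HasUniformMarginals μ) {k : ℕ}
    (hs : IsSymmetricOfOrder k μ) {E : Set (Fin k → ℝ × ℝ)}
    (A B : Equiv.Perm (Fin k) → Prop) [DecidablePred A] [DecidablePred B]
    (hE : ∀ ρ σ, ∀ v ∈ orderEvent ρ σ, (v ∈ E ↔ A ρ ∧ B σ)) :
    (Measure.pi fun _ : Fin k => μ).real E =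
      ((Finset.univ.filter A).card / k.factorial) *
        ((Finset.univ.filter B).card / k.factorial) := by
  rw [h.real_eq_sum (fun ρ σ => A ρ ∧ B σ) hE]
  -- By symmetry every pair (ρ, σ) carries mass 1/(k!)², so the double sum factors into two counts.
  simp_rw [hs _, ite_and]
  have (ρ : Equiv.Perm (Fin k)) : (∑ σ : Equiv.Perm (Fin k),
      if A ρ then (if B σ then (1 : ℝ) / k.factorial / k.factorial else 0) else 0) =
      if A ρ then ((Finset.univ.filter B).card : ℝ) / k.factorial / k.factorial else 0 := by
    split_ifs
    · rw [← Finset.sum_filter]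
      simp
      ring
    · simp
  simp_rw [this]
  rw [← Finset.sum_filter]
  simp
  ring

/-- Given point 0, points 1 and 2 fall into its quadrant independently. Each of the two coordinate
conditions holds for 8 of the 24 orders, whence (1/3)². Point 3 is idle; it is there so that
4-symmetry applies. -/
theorem integral_cornerMass_sq (h : HasUniformMarginals μ) (hs : IsSymmetricOfOrder 4 μ) :
    ∫ z, cornerMass μ z ^ 2 ∂μ = 1 / 9 := by
  have := h.prob
  let E : Set (Fin 4 → ℝ × ℝ) :=
    {v | ((v 1).1 < (v 0).1 ∧ (v 2).1 < (v 0).1) ∧ ((v 1).2 < (v 0).2 ∧ (v 2).2 < (v 0).2)}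
  have hEm : MeasurableSet E := by
    simp only [E, ofPred_and]
    refine MeasurableSet.inter (.inter ?_ ?_) (.inter ?_ ?_) <;>
    exact measurableSet_lt (by fun_prop) (by fun_prop)
  have h1 := h.real_eq_of_isSymmetricOfOrder hs (E := E) (fun ρ => ρ 1 < ρ 0 ∧ ρ 2 < ρ 0)
    (fun σ => σ 1 < σ 0 ∧ σ 2 < σ 0) (fun ρ σ v hv => by
      simp only [E, mem_ofPred_eq, (hv _ _).1, (hv _ _).2])
  rw [real_pi_fin_succ hEm] at h1
  rw [show (Finset.univ.filter fun ρ : Equiv.Perm (Fin 4) => ρ 1 < ρ 0 ∧ ρ 2 < ρ 0).card = 8 by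
    decide +kernel] at h1
  have h2 (z : ℝ × ℝ) : (Measure.pi fun _ : Fin 3 => μ).real
      {w | (Fin.cons z w : Fin 4 → ℝ × ℝ) ∈ E} = cornerMass μ z ^ 2 := by
    have := real_pi_univ_pi (μ := μ) ![Iio z.1 ×ˢ Iio z.2, Iio z.1 ×ˢ Iio z.2, univ]
    simp only [Fin.prod_univ_three, Fin.forall_fin_succ] at this
    simp [← cornerMass.eq_1] at this
    rw [sq, ← this]
    congr 1
    ext w
    simp [E, Fin.cons]
    tauto
  simp_rw [h2] at h1
  rw [h1]
  norm_num [Nat.factorial]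

/-- Given point 0, point 1 is in its quadrant, point 2 in the strip to the west (mass x) and point 3
in the strip to the south (mass y). The conditions on abscissas and on ordinates have probability
1/3 each. -/
theorem integral_cornerMass_mul (h : HasUniformMarginals μ) (hs : IsSymmetricOfOrder 4 μ) :
    ∫ z, cornerMass μ z * (z.1 * z.2) ∂μ = 1 / 9 := by
  have := h.prob
  let E : Set (Fin 4 → ℝ × ℝ) :=
    {v | ((v 1).1 < (v 0).1 ∧ (v 2).1 < (v 0).1) ∧ ((v 1).2 < (v 0).2 ∧ (v 3).2 < (v 0).2)}
  have hEm : MeasurableSet E := by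
    simp only [E, ofPred_and]
    refine MeasurableSet.inter (.inter ?_ ?_) (.inter ?_ ?_) <;>
    exact measurableSet_lt (by fun_prop) (by fun_prop)
  have h1 := h.real_eq_of_isSymmetricOfOrder hs (E := E) (fun ρ => ρ 1 < ρ 0 ∧ ρ 2 < ρ 0)
    (fun σ => σ 1 < σ 0 ∧ σ 3 < σ 0) (fun ρ σ v hv => by
      simp only [E, mem_ofPred_eq, (hv _ _).1, (hv _ _).2])
  rw [real_pi_fin_succ hEm] at h1
  rw [show (Finset.univ.filter fun ρ : Equiv.Perm (Fin 4) => ρ 1 < ρ 0 ∧ ρ 2 < ρ 0).card = 8 by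
    decide +kernel, show (Finset.univ.filter fun ρ : Equiv.Perm (Fin 4) =>
      ρ 1 < ρ 0 ∧ ρ 3 < ρ 0).card = 8 by decide +kernel] at h1
  have h2 : ∀ᵐ z ∂μ, (Measure.pi fun _ : Fin 3 => μ).real
      {w | (Fin.cons z w : Fin 4 → ℝ × ℝ) ∈ E} = cornerMass μ z * (z.1 * z.2) := by
    filter_upwards [h.ae_mem] with z hz
    have := real_pi_univ_pi (μ := μ) ![Iio z.1 ×ˢ Iio z.2, {p | p.1 < z.1}, {p | p.2 < z.2}]
    simp only [Fin.prod_univ_three, Fin.forall_fin_succ] at this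
    simp [← cornerMass.eq_1, h.real_fst_lt hz.1, h.real_snd_lt hz.2] at this
    rw [← mul_assoc, ← this]
    congr 1
    ext w
    simp [E, Fin.cons]
    tauto
  rw [integral_congr_ae h2] at h1
  rw [h1]
  norm_num [Nat.factorial]

/-- Taking the abscissa of the corner from point 0 and its ordinate from point 1 makes the corner
distributed according to the product of the marginals; points 2 and 3 must lie in its quadrant. -/
theorem integral_cornerMass_sq_prod (h : HasUniformMarginals μ) (hs : IsSymmetricOfOrder 4 μ) :
    ∫ z, cornerMass μ z ^ 2 ∂((volume.restrict (Icc 0 1)).prod (volume.restrict (Icc 0 1))) =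
      1 / 9 := by
  have := h.prob
  let E : Set (Fin 4 → ℝ × ℝ) :=
    {v | ((v 2).1 < (v 0).1 ∧ (v 3).1 < (v 0).1) ∧ ((v 2).2 < (v 1).2 ∧ (v 3).2 < (v 1).2)}
  have hEm : MeasurableSet E := by
    simp only [E, ofPred_and]
    refine MeasurableSet.inter (.inter ?_ ?_) (.inter ?_ ?_) <;>
    exact measurableSet_lt (by fun_prop) (by fun_prop)
  have h1 := h.real_eq_of_isSymmetricOfOrder hs (E := E) (fun ρ => ρ 2 < ρ 0 ∧ ρ 3 < ρ 0)
    (fun σ => σ 2 < σ 1 ∧ σ 3 < σ 1) (fun ρ σ v hv => by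
      simp only [E, mem_ofPred_eq, (hv _ _).1, (hv _ _).2])
  rw [real_pi_fin_succ hEm] at h1
  rw [show (Finset.univ.filter fun ρ : Equiv.Perm (Fin 4) => ρ 2 < ρ 0 ∧ ρ 3 < ρ 0).card = 8 by
    decide +kernel, show (Finset.univ.filter fun ρ : Equiv.Perm (Fin 4) =>
      ρ 2 < ρ 1 ∧ ρ 3 < ρ 1).card = 8 by decide +kernel] at h1
  have h2 (z : ℝ × ℝ) : (Measure.pi fun _ : Fin 3 => μ).real
      {w | (Fin.cons z w : Fin 4 → ℝ × ℝ) ∈ E} = ∫ z', cornerMass μ (z.1, z'.2) ^ 2 ∂μ := by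
    have hm : Measurable fun w : Fin 3 → ℝ × ℝ => (Fin.cons z w : Fin 4 → ℝ × ℝ) := by
      rw [measurable_pi_iff]
      intro i
      refine Fin.cases ?_ (fun j => ?_) i
      · simp
      · simpa using measurable_pi_apply j
    refine (real_pi_fin_succ (hm hEm)).trans ?_
    congr 1
    ext z'
    have := real_pi_univ_pi (μ := μ) ![Iio z.1 ×ˢ Iio z'.2, Iio z.1 ×ˢ Iio z'.2]
    simp only [Fin.prod_univ_two, Fin.forall_fin_succ] at this
    simp at this
    rw [sq, cornerMass, ← this]
    congr 1
    ext w
    simp [E, Fin.cons]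
    tauto
  simp_rw [h2] at h1
  have hint : Integrable (fun z => cornerMass μ z ^ 2)
      ((μ.map Prod.fst).prod (μ.map Prod.snd)) := by
    have := Measure.isProbabilityMeasure_map (μ := μ) measurable_fst.aemeasurable
    have := Measure.isProbabilityMeasure_map (μ := μ) measurable_snd.aemeasurable
    refine integrable_of_ae_abs_le (measurable_cornerMass.pow_const 2) (C := 1) (ae_of_all _ fun z => ?_)
    rw [abs_pow]
    exact pow_le_one₀ (abs_nonneg _) (abs_cornerMass_le_one z)
  have hms : Measurable fun z => cornerMass μ z ^ 2 := measurable_cornerMass.pow_const 2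
  rw [show (volume.restrict (Icc (0 : ℝ) 1)).prod (volume.restrict (Icc (0 : ℝ) 1)) =
    (μ.map Prod.fst).prod (μ.map Prod.snd) by rw [h.map_fst, h.map_snd]]
  rw [integral_prod _ hint, integral_map measurable_fst.aemeasurable]
  · have (z : ℝ × ℝ) : ∫ y, cornerMass μ (z.1, y) ^ 2 ∂μ.map Prod.snd =
        ∫ z', cornerMass μ (z.1, z'.2) ^ 2 ∂μ :=
      integral_map measurable_snd.aemeasurable
        (hms.comp measurable_prodMk_left).aestronglyMeasurable
    simp_rw [this, h1]
    norm_num [Nat.factorial]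
  · exact hint.aestronglyMeasurable.integral_prod_right'


/-- Vertical and horizontal lines are null because the marginals have no atoms, so the indicators of
quadrants converge almost everywhere and dominated convergence applies. -/
theorem continuous_cornerMass (h : HasUniformMarginals μ) : Continuous (cornerMass μ) := by
  have := h.prob
  have hrep (z : ℝ × ℝ) : cornerMass μ z = ∫ p, (Iio z.1 ×ˢ Iio z.2).indicator 1 p ∂μ :=
    (integral_indicator_one (measurableSet_Iio.prod measurableSet_Iio)).symm
  rw [continuous_iff_continuousAt]
  intro z
  have : Tendsto (fun z' : ℝ × ℝ => ∫ p, (Iio z'.1 ×ˢ Iio z'.2).indicator (1 : ℝ × ℝ → ℝ) p ∂μ)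
      (𝓝 z) (𝓝 (∫ p, (Iio z.1 ×ˢ Iio z.2).indicator (1 : ℝ × ℝ → ℝ) p ∂μ)) := by
    refine tendsto_integral_filter_of_dominated_convergence (fun _ => (1 : ℝ)) ?_ ?_
      (integrable_const _) ?_
    · exact Eventually.of_forall fun z' => (measurable_one.indicator
        (measurableSet_Iio.prod measurableSet_Iio)).aestronglyMeasurable
    · refine Eventually.of_forall fun z' => ae_of_all _ fun p => ?_
      by_cases hp : p ∈ Iio z'.1 ×ˢ Iio z'.2
      · rw [indicator_of_mem hp]; simp
      · rw [indicator_of_notMem hp]; simp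
    · have h1 : ∀ᵐ p ∂μ, p.1 ≠ z.1 := by
        refine ae_of_ae_map (p := fun x : ℝ => x ≠ z.1) measurable_fst.aemeasurable ?_
        rw [h.map_fst]
        exact ae_iff.2 (by simp)
      have h2 : ∀ᵐ p ∂μ, p.2 ≠ z.2 := by
        refine ae_of_ae_map (p := fun x : ℝ => x ≠ z.2) measurable_snd.aemeasurable ?_
        rw [h.map_snd]
        exact ae_iff.2 (by simp)
      filter_upwards [h1, h2] with p hp1 hp2
      refine tendsto_const_nhds.congr' ?_
      filter_upwards [eventually_lt_iff_lt (tendsto_const_nhds (x := p.1))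
        (continuous_fst.tendsto z) hp1, eventually_lt_iff_lt (tendsto_const_nhds (x := p.2))
        (continuous_snd.tendsto z) hp2] with z' h1 h2
      simp only [indicator, mem_prod, mem_Iio, h1, h2]
  rw [ContinuousAt, funext hrep]
  exact this

theorem integral_Ioi_indicator {s : ℝ} (hs : s ∈ Icc (0 : ℝ) 1) :
    ∫ x in Icc (0 : ℝ) 1, (Ioi s).indicator id x = (1 - s ^ 2) / 2 := by
  rw [setIntegral_indicator measurableSet_Ioi,
    show Icc 0 1 ∩ Ioi s = Ioc s 1 by
      ext y; simp only [mem_inter_iff, mem_Ioi, mem_Icc, mem_Ioc]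
      exact ⟨fun h => ⟨h.2, h.1.2⟩, fun h => ⟨⟨hs.1.trans h.1.le, h.2⟩, h.1⟩⟩,
    ← intervalIntegral.integral_of_le hs.2]
  simp

theorem integral_pow_restrict_Icc (n : ℕ) : ∫ x in Icc (0 : ℝ) 1, x ^ n = 1 / (n + 1) := by
  rw [integral_Icc_eq_integral_Ioc, ← intervalIntegral.integral_of_le zero_le_one]
  simp

/-- Write the corner mass as an integral over p and exchange the integrals. The inner one is the
product of ∫ x dx over (p.1, 1] and ∫ y dy over (p.2, 1], that is (1 - p.1²)(1 - p.2²)/4, and both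
marginals have second moment 1/3. -/
theorem integral_cornerMass_mul_prod (h : HasUniformMarginals μ) :
    ∫ z, cornerMass μ z * (z.1 * z.2)
        ∂((volume.restrict (Icc 0 1)).prod (volume.restrict (Icc 0 1))) =
      1 / 4 * (1 / 3 + ∫ p, (p.1 * p.2) ^ 2 ∂μ) := by
  have := h.prob
  set ν : Measure ℝ := volume.restrict (Icc 0 1) with hν
  have hνae : ∀ᵐ z ∂ν.prod ν, z.1 ∈ Icc (0 : ℝ) 1 ∧ z.2 ∈ Icc (0 : ℝ) 1 := by
    rw [hν, Measure.prod_restrict]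
    exact ae_restrict_mem (measurableSet_Icc.prod measurableSet_Icc)
  have : IsFiniteMeasure ν := by rw [hν]; infer_instance
  let K : ℝ × ℝ → ℝ × ℝ → ℝ := fun z p =>
    (Ioi p.1).indicator id z.1 * (Ioi p.2).indicator id z.2
  have hK1 (z : ℝ × ℝ) : cornerMass μ z * (z.1 * z.2) = ∫ p, K z p ∂μ := by
    have : ∀ p, K z p = (Iio z.1 ×ˢ Iio z.2).indicator 1 p * (z.1 * z.2) := fun p => by
      by_cases h1 : p.1 < z.1 <;> by_cases h2 : p.2 < z.2 <;> simp [K, indicator, h1, h2]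
    simp_rw [this]
    rw [integral_mul_const, integral_indicator_one (measurableSet_Iio.prod measurableSet_Iio)]
    rfl
  have hKm : Measurable (Function.uncurry K) := by
    have hi : Measurable fun q : ℝ × ℝ => (Ioi q.1).indicator id q.2 := by
      have : (fun q : ℝ × ℝ => (Ioi q.1).indicator id q.2) =
          {q : ℝ × ℝ | q.1 < q.2}.indicator (fun q => q.2) := by
        ext q; simp [indicator]
      rw [this]
      exact measurable_snd.indicator (measurableSet_lt measurable_fst measurable_snd)
    exact (hi.comp (f := fun q : (ℝ × ℝ) × (ℝ × ℝ) => (q.2.1, q.1.1)) (by fun_prop)).mul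
      (hi.comp (f := fun q : (ℝ × ℝ) × (ℝ × ℝ) => (q.2.2, q.1.2)) (by fun_prop))
  have hKint : Integrable (Function.uncurry K) ((ν.prod ν).prod μ) := by
    refine integrable_of_ae_abs_le hKm (C := 1) ?_
    filter_upwards [Measure.quasiMeasurePreserving_fst.ae hνae] with q hq
    have hb (s x : ℝ) (hx : x ∈ Icc (0 : ℝ) 1) : |(Ioi s).indicator id x| ≤ 1 := by
      by_cases hs : x ∈ Ioi s
      · rw [indicator_of_mem hs]; exact abs_le.2 ⟨by linarith [hx.1, id_eq x], hx.2⟩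
      · rw [indicator_of_notMem hs]; simp
    simp only [Function.uncurry, K, abs_mul]
    exact mul_le_one₀ (hb _ _ hq.1) (abs_nonneg _) (hb _ _ hq.2)
  simp_rw [hK1]
  rw [integral_integral_swap hKint]
  have hK2 : ∀ᵐ p ∂μ, ∫ z, K z p ∂ν.prod ν =
      1 / 4 * (1 - p.1 ^ 2 - p.2 ^ 2 + (p.1 * p.2) ^ 2) := by
    filter_upwards [h.ae_mem] with p hp
    simp only [K]
    rw [integral_prod_mul (fun x => (Ioi p.1).indicator id x) (fun y => (Ioi p.2).indicator id y),
      integral_Ioi_indicator hp.1, integral_Ioi_indicator hp.2]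
    ring
  rw [integral_congr_ae hK2, integral_const_mul]
  have i1 : Integrable (fun p : ℝ × ℝ => p.1 ^ 2) μ := by
    refine integrable_of_ae_abs_le (by fun_prop) (C := 1) ?_
    filter_upwards [h.ae_mem] with p hp
    rw [abs_of_nonneg (sq_nonneg _)]
    exact pow_le_one₀ hp.1.1 hp.1.2
  have i2 : Integrable (fun p : ℝ × ℝ => p.2 ^ 2) μ := by
    refine integrable_of_ae_abs_le (by fun_prop) (C := 1) ?_
    filter_upwards [h.ae_mem] with p hp
    rw [abs_of_nonneg (sq_nonneg _)]
    exact pow_le_one₀ hp.2.1 hp.2.2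
  have i3 : Integrable (fun p : ℝ × ℝ => (p.1 * p.2) ^ 2) μ := by
    refine integrable_of_ae_abs_le (by fun_prop) (C := 1) ?_
    filter_upwards [h.ae_mem] with p hp
    rw [abs_of_nonneg (sq_nonneg _)]
    exact pow_le_one₀ (mul_nonneg hp.1.1 hp.2.1) (mul_le_one₀ hp.1.2 hp.2.1 hp.2.2)
  have e1 : ∫ p, p.1 ^ 2 ∂μ = 1 / 3 := by
    have := integral_pow_restrict_Icc 2
    rw [← h.map_fst, integral_map measurable_fst.aemeasurable (by fun_prop)] at this
    rw [this]; norm_num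
  have e2 : ∫ p, p.2 ^ 2 ∂μ = 1 / 3 := by
    have := integral_pow_restrict_Icc 2
    rw [← h.map_snd, integral_map measurable_snd.aemeasurable (by fun_prop)] at this
    rw [this]; norm_num
  have i4 : Integrable (fun p : ℝ × ℝ => 1 - p.1 ^ 2) μ := (integrable_const _).sub i1
  have i5 : Integrable (fun p : ℝ × ℝ => 1 - p.1 ^ 2 - p.2 ^ 2) μ := i4.sub i2
  rw [integral_add i5 i3, integral_sub i4 i2, integral_sub (integrable_const _) i1, e1, e2]
  simp
  norm_num

/-- Open south-west quadrants form a π-system generating the Borel sets of the plane. -/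
theorem eq_prod_of_cornerMass (h : HasUniformMarginals μ)
    (hF : ∀ x ∈ Icc (0 : ℝ) 1, ∀ y ∈ Icc (0 : ℝ) 1, cornerMass μ (x, y) = x * y) :
    μ = uniformSquare := by
  have := h.prob
  have hu : uniformSquare = (volume.restrict (Icc 0 1)).prod (volume.restrict (Icc 0 1)) := by
    rw [Measure.prod_restrict]; rfl
  have h1 : ∀ᵐ p ∂μ, p.1 ∈ Ico (0 : ℝ) 1 := by
    refine ae_of_ae_map (p := fun x : ℝ => x ∈ Ico (0 : ℝ) 1) measurable_fst.aemeasurable ?_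
    rw [h.map_fst, ← restrict_Ico_eq_restrict_Icc]
    exact ae_restrict_mem measurableSet_Ico
  have h2 : ∀ᵐ p ∂μ, p.2 ∈ Ico (0 : ℝ) 1 := by
    refine ae_of_ae_map (p := fun x : ℝ => x ∈ Ico (0 : ℝ) 1) measurable_snd.aemeasurable ?_
    rw [h.map_snd, ← restrict_Ico_eq_restrict_Icc]
    exact ae_restrict_mem measurableSet_Ico
  -- Quadrants with arbitrary real corners are reduced to corners in the square by clamping to
  -- [0,1]. Since almost all points have coordinates in [0,1), this loses no mass.
  have hc (x : ℝ) : max 0 (min x 1) ∈ Icc (0 : ℝ) 1 :=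
    ⟨le_max_left _ _, max_le zero_le_one (min_le_right _ _)⟩
  have hlt {t : ℝ} (x : ℝ) (ht : t ∈ Ico (0 : ℝ) 1) : t < x ↔ t < max 0 (min x 1) := by
    simp [ht.1.not_gt, ht.2]
  have hreal (x : ℝ) : (volume.restrict (Icc (0 : ℝ) 1)).real (Iio x) = max 0 (min x 1) := by
    rw [← real_iio_restrict_Icc (hc x), ← restrict_Ico_eq_restrict_Icc]
    refine measureReal_congr ?_
    filter_upwards [ae_restrict_mem measurableSet_Ico] with t ht
    exact propext (hlt x ht)
  rw [hu]
  refine (Measure.prod_eq_generateFrom (C := range Iio) (D := range Iio)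
    ((borel_eq_generateFrom_Iio ℝ).symm.trans BorelSpace.measurable_eq.symm)
    ((borel_eq_generateFrom_Iio ℝ).symm.trans BorelSpace.measurable_eq.symm)
    isPiSystem_Iio isPiSystem_Iio ?_ ?_ ?_).symm
  · exact ⟨fun n => Iio (n : ℝ), fun n => mem_range_self _, fun n => measure_lt_top _ _,
      iUnion_eq_univ_iff.2 fun x => exists_nat_gt x⟩
  · exact ⟨fun n => Iio (n : ℝ), fun n => mem_range_self _, fun n => measure_lt_top _ _,
      iUnion_eq_univ_iff.2 fun x => exists_nat_gt x⟩
  · rintro _ ⟨x, rfl⟩ _ ⟨y, rfl⟩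
    rw [← ENNReal.toReal_eq_toReal_iff' (measure_ne_top _ _)
      (ENNReal.mul_ne_top (measure_ne_top _ _) (measure_ne_top _ _)), ENNReal.toReal_mul]
    change μ.real _ = (volume.restrict (Icc (0 : ℝ) 1)).real _ *
      (volume.restrict (Icc (0 : ℝ) 1)).real _
    rw [hreal, hreal, ← hF _ (hc x) _ (hc y)]
    refine measureReal_congr ?_
    filter_upwards [h1, h2] with p hp1 hp2
    exact propext (and_congr (hlt x hp1) (hlt y hp2))

/-- A measure with uniform marginals that is `4`-symmetric is the uniform measure. -/
theorem eq_uniformSquare_of_isSymmetricOfOrder (h : HasUniformMarginals μ)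
    (hs : IsSymmetricOfOrder 4 μ) : μ = uniformSquare := by
  have := h.prob
  set ν : Measure ℝ := volume.restrict (Icc 0 1) with hν
  have : IsFiniteMeasure ν := by rw [hν]; infer_instance
  have hexp (z : ℝ × ℝ) : (cornerMass μ z - z.1 * z.2) ^ 2 =
      cornerMass μ z ^ 2 - 2 * (cornerMass μ z * (z.1 * z.2)) + (z.1 * z.2) ^ 2 := by ring
  have hint (κ : Measure (ℝ × ℝ)) [IsFiniteMeasure κ]
      (hκ : ∀ᵐ z ∂κ, z.1 ∈ Icc (0 : ℝ) 1 ∧ z.2 ∈ Icc (0 : ℝ) 1) :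
      Integrable (fun z => (cornerMass μ z - z.1 * z.2) ^ 2) κ ∧
      ∫ z, (cornerMass μ z - z.1 * z.2) ^ 2 ∂κ = ∫ z, cornerMass μ z ^ 2 ∂κ -
        2 * ∫ z, cornerMass μ z * (z.1 * z.2) ∂κ + ∫ z, (z.1 * z.2) ^ 2 ∂κ := by
    have hF : Measurable (cornerMass μ) := measurable_cornerMass
    have hb : ∀ᵐ z ∂κ, |z.1 * z.2| ≤ 1 := by
      filter_upwards [hκ] with z hz
      rw [abs_of_nonneg (mul_nonneg hz.1.1 hz.2.1)]
      exact mul_le_one₀ hz.1.2 hz.2.1 hz.2.2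
    have i1 : Integrable (fun z => cornerMass μ z ^ 2) κ := by
      refine integrable_of_ae_abs_le (by fun_prop) (C := 1) (ae_of_all _ fun z => ?_)
      rw [abs_pow]
      exact pow_le_one₀ (abs_nonneg _) (abs_cornerMass_le_one z)
    have i2 : Integrable (fun z => cornerMass μ z * (z.1 * z.2)) κ := by
      refine integrable_of_ae_abs_le (by fun_prop) (C := 1) ?_
      filter_upwards [hb] with z hz
      rw [abs_mul]
      exact mul_le_one₀ (abs_cornerMass_le_one z) (abs_nonneg _) hz
    have i3 : Integrable (fun z : ℝ × ℝ => (z.1 * z.2) ^ 2) κ := by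
      refine integrable_of_ae_abs_le (by fun_prop) (C := 1) ?_
      filter_upwards [hb] with z hz
      rw [abs_pow]
      exact pow_le_one₀ (abs_nonneg _) hz
    simp_rw [hexp]
    have i4 : Integrable (fun z => cornerMass μ z ^ 2 - 2 * (cornerMass μ z * (z.1 * z.2))) κ :=
      i1.sub (i2.const_mul 2)
    refine ⟨i4.add i3, ?_⟩
    rw [integral_add i4 i3, integral_sub i1 (i2.const_mul 2),
      integral_const_mul]
  have hνae : ∀ᵐ z ∂ν.prod ν, z.1 ∈ Icc (0 : ℝ) 1 ∧ z.2 ∈ Icc (0 : ℝ) 1 := by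
    rw [hν, Measure.prod_restrict]
    exact ae_restrict_mem (measurableSet_Icc.prod measurableSet_Icc)
  have h1 := (hint μ h.ae_mem).2
  have h2 := hint (ν.prod ν) hνae
  rw [h.integral_cornerMass_sq hs, h.integral_cornerMass_mul hs] at h1
  have h3 : ∫ z, (z.1 * z.2) ^ 2 ∂ν.prod ν = 1 / 9 := by
    simp_rw [mul_pow]
    rw [integral_prod_mul (fun x : ℝ => x ^ 2) (fun y : ℝ => y ^ 2), integral_pow_restrict_Icc]
    norm_num
  have h4 := h2.2
  rw [h.integral_cornerMass_sq_prod hs, h.integral_cornerMass_mul_prod, h3] at h4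
  have h5 : 0 ≤ ∫ z, (cornerMass μ z - z.1 * z.2) ^ 2 ∂μ := integral_nonneg fun z => sq_nonneg _
  have h6 : 0 ≤ ∫ z, (cornerMass μ z - z.1 * z.2) ^ 2 ∂ν.prod ν :=
    integral_nonneg fun z => sq_nonneg _
  -- With Q = ∫ (xy)² dμ, the two mean squares are Q - 1/9 (against μ) and -(Q - 1/9)/2 (against
  -- Lebesgue measure), so nonnegativity of both forces Q = 1/9.
  have h7 : ∫ z, (cornerMass μ z - z.1 * z.2) ^ 2 ∂ν.prod ν = 0 := by linarith
  have h8 := (integral_eq_zero_iff_of_nonneg (fun z => sq_nonneg _) h2.1).1 h7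
  have h9 : cornerMass μ =ᵐ[volume.restrict (Icc (0 : ℝ) 1 ×ˢ Icc (0 : ℝ) 1)]
      fun z => z.1 * z.2 := by
    rw [hν, Measure.prod_restrict] at h8
    filter_upwards [h8] with z hz
    simpa [sub_eq_zero] using hz
  have h10 := Measure.eqOn_of_ae_eq h9 h.continuous_cornerMass.continuousOn
    -- Almost everywhere equality of continuous functions extends to the closed square, which is the
    -- closure of its interior.
    (by fun_prop) (by
      rw [interior_prod_eq, closure_prod_eq, interior_Icc, closure_Ioo zero_ne_one])
  exact h.eq_prod_of_cornerMass fun x hx y hy => h10 ⟨hx, hy⟩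

end HasUniformMarginals

end

/-! ### Permutations read off from finitely many points -/

-- A k-subset induces at most one pattern. Only an upper bound is stated because for k > m all
-- densities are 0 by convention.
open Classical in
theorem sum_permDensity_le_one {k m : ℕ} (τ : Equiv.Perm (Fin m)) :
    ∑ π : Equiv.Perm (Fin k), permDensity π τ ≤ 1 := by
  unfold permDensity
  rw [← Finset.sum_div]
  refine div_le_one_of_le₀ ?_ (Nat.cast_nonneg _)
  rw [← Nat.cast_sum, Nat.cast_le, ← Finset.card_biUnion]
  · refine Finset.card_le_card fun X hX => ?_
    obtain ⟨π, -, hX⟩ := Finset.mem_biUnion.1 hX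
    obtain ⟨h, -⟩ := (Finset.mem_filter.1 hX).2
    exact Finset.mem_filter.2 ⟨Finset.mem_univ _, h⟩
  · intro π _ σ _ hne
    refine Finset.disjoint_left.2 fun X hX hX' => hne (perm_eq_of_lt_iff_lt fun i j => ?_)
    obtain ⟨h, h1⟩ := (Finset.mem_filter.1 hX).2
    obtain ⟨_, h2⟩ := (Finset.mem_filter.1 hX').2
    rw [← not_le, ← not_le, ← h1, ← h2]

/-- Ranks obtained by sorting, which breaks ties arbitrarily; for this reason only one implication
survives. -/
theorem exists_perm_lt_of_lt {n : ℕ} (f : Fin n → ℝ) :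
    ∃ r : Equiv.Perm (Fin n), ∀ i j, f i < f j → r i < r j := by
  refine ⟨(Tuple.sort f)⁻¹, fun i j hij => ?_⟩
  by_contra h
  have := Tuple.monotone_sort f (not_lt.1 h)
  simp at this
  exact absurd hij this.not_gt

theorem lt_iff_lt_of_imp {α : Type*} {k : ℕ} [LinearOrder α] {f : Fin k → α}
    {ρ : Equiv.Perm (Fin k)} (h : ∀ i j, ρ i < ρ j → f i < f j) (i j : Fin k) :
    f i < f j ↔ ρ i < ρ j := by
  refine ⟨fun hij => ?_, h i j⟩
  rcases lt_trichotomy (ρ i) (ρ j) with h1 | h1 | h1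
  · exact h1
  · rw [ρ.injective h1] at hij; exact absurd hij (lt_irrefl _)
  · exact absurd hij (h j i h1).not_gt

open Classical in
/-- Points in the plane, with ties broken arbitrarily, define a permutation whose densities are at
least the proportions of tuples of points in the corresponding relative order. -/
theorem exists_perm_le_permDensity {n : ℕ} (z : Fin n → ℝ × ℝ) :
    ∃ τ : Equiv.Perm (Fin n), ∀ (k : ℕ) (π : Equiv.Perm (Fin k)),
      ((Finset.univ.filter fun w : Fin k → Fin n => z ∘ w ∈ patternEvent π).card : ℝ) / n ^ k ≤
        permDensity π τ := by
  obtain ⟨rx, hrx⟩ := exists_perm_lt_of_lt fun i => (z i).1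
  obtain ⟨ry, hry⟩ := exists_perm_lt_of_lt fun i => (z i).2
  -- The point of abscissa rank i is `rx⁻¹ i`, and its ordinate rank is the value of the permutation
  -- at i.
  refine ⟨ry * rx⁻¹, fun k π => ?_⟩
  let good : Finset (Finset (Fin n)) := Finset.univ.filter fun X : Finset (Fin n) =>
      ∃ h : X.card = k, ∀ i j : Fin k, (ry * rx⁻¹) (X.orderEmbOfFin h i) ≤
        (ry * rx⁻¹) (X.orderEmbOfFin h j) ↔ π i ≤ π j
  let W : Finset (Fin k → Fin n) := Finset.univ.filter fun w => z ∘ w ∈ patternEvent π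
  have hW (w : Fin k → Fin n) : ∃ ρ : Equiv.Perm (Fin k), w ∈ W → z ∘ w ∈ orderEvent ρ (π * ρ) := by
    by_cases hw : w ∈ W
    · obtain ⟨ρ, hρ⟩ := mem_iUnion.1 (Finset.mem_filter.1 hw).2
      exact ⟨ρ, fun _ => hρ⟩
    · exact ⟨1, fun h => absurd h hw⟩
  choose ρ hρ using hW
  have hx (w) (hw : w ∈ W) (i j : Fin k) : rx (w i) < rx (w j) ↔ ρ w i < ρ w j :=
    lt_iff_lt_of_imp (f := fun i => rx (w i)) (fun i j hij => hrx _ _ ((hρ w hw i j).1.2 hij)) i j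
  have hy (w) (hw : w ∈ W) (i j : Fin k) : ry (w i) < ry (w j) ↔ (π * ρ w) i < (π * ρ w) j :=
    lt_iff_lt_of_imp (f := fun i => ry (w i)) (fun i j hij => hry _ _ ((hρ w hw i j).2.2 hij)) i j
  -- The abscissa ranks of the chosen points in increasing order; their set `X w` is a k-subset on
  -- which the permutation induces `π`.
  let e (w : Fin k → Fin n) (i : Fin k) : Fin n := rx (w ((ρ w)⁻¹ i))
  have he (w) (hw : w ∈ W) : StrictMono (e w) := fun i j hij => by
    simpa [e, hx w hw] using hij
  let X (w : Fin k → Fin n) : Finset (Fin n) := Finset.univ.image (e w)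
  have hXc (w) (hw : w ∈ W) : (X w).card = k := by
    rw [Finset.card_image_of_injective _ (he w hw).injective, Finset.card_univ, Fintype.card_fin]
  have hXe (w) (hw : w ∈ W) : e w = (X w).orderEmbOfFin (hXc w hw) :=
    Finset.orderEmbOfFin_unique _ (fun i => Finset.mem_image_of_mem _ (Finset.mem_univ i)) (he w hw)
  -- A tuple is recovered from its subset together with the order `ρ w` in which the points are
  -- named, so each good subset comes from at most k! tuples.
  have hcard : W.card ≤ good.card * k.factorial := by
    rw [show k.factorial = (Finset.univ : Finset (Equiv.Perm (Fin k))).card by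
      rw [Finset.card_univ, Fintype.card_perm, Fintype.card_fin], ← Finset.card_product]
    refine Finset.card_le_card_of_injOn (fun w => (X w, ρ w)) (fun w hw => ?_) ?_
    · refine Finset.mem_coe.2 (Finset.mem_product.2 ⟨Finset.mem_filter.2 ⟨Finset.mem_univ _,
        hXc w hw, fun i j => ?_⟩, Finset.mem_univ _⟩)
      rw [← hXe w hw, ← not_lt, ← not_lt, not_iff_not]
      simp [e, hy w hw]
    · intro w hw w' hw' hww
      have h1 : X w = X w' := congrArg Prod.fst hww
      have h2 : ρ w = ρ w' := congrArg Prod.snd hww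
      have h3 : e w = e w' := by
        rw [hXe w hw, hXe w' hw']
        simp only [h1]
      funext i
      have := congrFun h3 (ρ w i)
      simpa [e, ← h2] using this
  change (W.card : ℝ) / n ^ k ≤ (good.card : ℝ) /
    ((Finset.univ.filter fun X : Finset (Fin n) => X.card = k).card : ℝ)
  have hch : (Finset.univ.filter fun X : Finset (Fin n) => X.card = k).card = n.choose k := by
    have := Finset.card_powersetCard k (Finset.univ : Finset (Fin n))
    rw [Finset.card_univ, Fintype.card_fin, Finset.powersetCard_eq_filter,
      Finset.powerset_univ] at this
    rw [← this]
  rw [hch]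
  -- If there are no k-subsets, both sides are 0. Otherwise the bound follows from k!·C(n,k) ≤ n^k.
  rcases Nat.eq_zero_or_pos (n.choose k) with h0 | h0
  · have : good.card = 0 := by
      have : good.card ≤ n.choose k := by
        rw [← hch]
        refine Finset.card_le_card fun X hX => ?_
        obtain ⟨h, -⟩ := (Finset.mem_filter.1 hX).2
        exact Finset.mem_filter.2 ⟨Finset.mem_univ _, h⟩
      omega
    rw [this, zero_mul] at hcard
    rw [Nat.le_zero.1 hcard, this]
    simp
  · have hpow : n.choose k * k.factorial ≤ n ^ k := by
      rw [mul_comm, ← Nat.descFactorial_eq_factorial_mul_choose]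
      exact Nat.descFactorial_le_pow n k
    have hn : 0 < n ^ k := lt_of_lt_of_le (Nat.mul_pos h0 k.factorial_pos) hpow
    rw [div_le_div_iff₀ (by exact_mod_cast hn) (by exact_mod_cast h0)]
    have : W.card * n.choose k ≤ good.card * n ^ k := by
      calc W.card * n.choose k ≤ good.card * k.factorial * n.choose k :=
            Nat.mul_le_mul_right _ hcard
        _ = good.card * (n.choose k * k.factorial) := by ring
        _ ≤ good.card * n ^ k := Nat.mul_le_mul_left _ hpow
    exact_mod_cast this

/-! ### Measures that are limits of permutations -/

/-- The index of the interval of length `1 / (n + 1)` that contains `u ∈ [0, 1)`. -/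
noncomputable def cellIndex (n : ℕ) (u : ℝ) : Fin (n + 1) := Fin.ofNat (n + 1) ⌊(n + 1) * u⌋₊

theorem cellIndex_val {n : ℕ} {u : ℝ} (hu : u ∈ Ico (0 : ℝ) 1) :
    (cellIndex n u : ℕ) = ⌊(n + 1) * u⌋₊ := by
  refine Nat.mod_eq_of_lt ?_
  rw [Nat.floor_lt (by have := hu.1; positivity)]
  push_cast
  nlinarith [hu.2]

theorem measurable_cellIndex (n : ℕ) : Measurable (cellIndex n) :=
  (measurable_of_countable (Fin.ofNat (n + 1))).comp
    (Nat.measurable_floor.comp (measurable_const_mul _))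

theorem real_cellIndex_eq (n : ℕ) (i : Fin (n + 1)) :
    ((volume.restrict (Ico (0 : ℝ) 1)).map (cellIndex n)).real {i} = 1 / ((n + 1 : ℕ) : ℝ) := by
  rw [map_measureReal_apply (measurable_cellIndex n) (measurableSet_singleton i),
    measureReal_restrict_apply (measurable_cellIndex n (measurableSet_singleton i))]
  have hn : (0 : ℝ) < n + 1 := by positivity
  have : cellIndex n ⁻¹' {i} ∩ Ico 0 1 = Ico ((i : ℝ) / (n + 1)) (((i : ℝ) + 1) / (n + 1)) := by
    ext u
    simp only [mem_inter_iff, mem_preimage, mem_singleton_iff]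
    have hi : (i : ℝ) + 1 ≤ n + 1 := by exact_mod_cast i.2
    have key (hu : u ∈ Ico (0 : ℝ) 1) :
        cellIndex n u = i ↔ (i : ℝ) ≤ (n + 1) * u ∧ (n + 1) * u < i + 1 := by
      rw [Fin.ext_iff, cellIndex_val hu, Nat.floor_eq_iff (mul_nonneg hn.le hu.1)]
    constructor
    · rintro ⟨h, hu⟩
      obtain ⟨h1, h2⟩ := (key hu).1 h
      exact ⟨by rw [div_le_iff₀ hn]; linarith, by rw [lt_div_iff₀ hn]; linarith⟩
    · rintro ⟨h1, h2⟩
      rw [div_le_iff₀ hn] at h1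
      rw [lt_div_iff₀ hn] at h2
      have hu : u ∈ Ico (0 : ℝ) 1 := by
        have : (0 : ℝ) ≤ i := Nat.cast_nonneg _
        constructor
        · by_contra h; nlinarith
        · by_contra h; nlinarith
      exact ⟨(key hu).2 ⟨by linarith, by linarith⟩, hu⟩
  rw [this]
  rw [Real.volume_real_Ico, max_eq_left]
  · push_cast; ring
  · rw [sub_nonneg]; gcongr; linarith

-- The index of the cell of a uniform number is uniform on the n + 1 indices, so the k-fold product
-- measure counts tuples of indices.
open Classical in
theorem real_pi_map_cellIndex {n k : ℕ} (z : Fin (n + 1) → ℝ × ℝ) {E : Set (Fin k → ℝ × ℝ)}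
    (hE : MeasurableSet E) :
    (Measure.pi fun _ : Fin k => (volume.restrict (Ico (0 : ℝ) 1)).map (z ∘ cellIndex n)).real E =
      ((Finset.univ.filter fun w : Fin k → Fin (n + 1) => z ∘ w ∈ E).card : ℝ) /
        ((n + 1 : ℕ) : ℝ) ^ k := by
  have hJ := measurable_cellIndex n
  have hz : Measurable z := measurable_of_countable z
  have hP : IsProbabilityMeasure (volume.restrict (Ico (0 : ℝ) 1)) := ⟨by simp⟩
  have := Measure.isProbabilityMeasure_map (μ := volume.restrict (Ico (0 : ℝ) 1)) hJ.aemeasurable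
  have := Measure.isProbabilityMeasure_map (μ := (volume.restrict (Ico (0 : ℝ) 1)).map (cellIndex n))
    hz.aemeasurable
  rw [← Measure.map_map hz hJ, ← Measure.pi_map_pi (fun _ => hz.aemeasurable),
    map_measureReal_apply (by fun_prop) hE]
  have hset : ((fun (w : Fin k → Fin (n + 1)) i => z (w i)) ⁻¹' E) =
      ((Finset.univ.filter fun w : Fin k → Fin (n + 1) => z ∘ w ∈ E : Finset _) : Set _) := by
    ext w; simp [Function.comp_def]
  rw [hset, ← sum_measureReal_singleton]
  have hs (w : Fin k → Fin (n + 1)) : (Measure.pi fun _ : Fin k =>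
      (volume.restrict (Ico (0 : ℝ) 1)).map (cellIndex n)).real {w} =
      (1 / ((n + 1 : ℕ) : ℝ)) ^ k := by
    have := real_pi_univ_pi (μ := (volume.restrict (Ico (0 : ℝ) 1)).map (cellIndex n))
      (fun i => {w i})
    simp only [real_cellIndex_eq, Finset.prod_const, Finset.card_univ, Fintype.card_fin] at this
    rw [← this]
    congr 1
    ext w'
    simp [funext_iff]
  simp only [hs, Finset.sum_const, nsmul_eq_mul, one_div, inv_pow]
  rw [div_eq_mul_inv]

/-- The permutations come from sampling `G` at i/(n+1). The corresponding step functions converge to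
`G` at its points of continuity, so the tuple proportions converge to the densities of the law of
`G`. -/
theorem exists_convergesToMeasure {G : ℝ → ℝ × ℝ} (hG : Measurable G)
    (hc : ∀ᵐ u ∂volume.restrict (Ico (0 : ℝ) 1), ContinuousAt G u)
    (hU : HasUniformMarginals ((volume.restrict (Ico (0 : ℝ) 1)).map G)) :
    ∃ (m : ℕ → ℕ) (τ : ∀ j, Equiv.Perm (Fin (m j))),
      ConvergesToMeasure m τ ((volume.restrict (Ico (0 : ℝ) 1)).map G) := by
  set P : Measure ℝ := volume.restrict (Ico (0 : ℝ) 1) with hPdef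
  have hP : IsProbabilityMeasure P := ⟨by simp [P]⟩
  let z (n : ℕ) (i : Fin (n + 1)) : ℝ × ℝ := G ((i : ℝ) / (n + 1))
  have hlim : ∀ᵐ u ∂P, Tendsto (fun n => (z n ∘ cellIndex n) u) atTop (𝓝 (G u)) := by
    filter_upwards [hc, ae_restrict_mem measurableSet_Ico] with u huc hu
    refine huc.tendsto.comp ?_
    have h1 := (tendsto_nat_floor_mul_div_atTop (R := ℝ) hu.1).comp
      (tendsto_natCast_atTop_atTop.comp (tendsto_add_atTop_nat 1))
    refine h1.congr fun n => ?_
    simp [cellIndex_val hu, mul_comm]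
  choose τ hτ using fun n => exists_perm_le_permDensity (z n)
  refine ⟨fun n => n + 1, τ, tendsto_add_atTop_nat 1, fun k π => ?_⟩
  have hz (n : ℕ) : Measurable (z n ∘ cellIndex n) :=
    (measurable_of_countable (z n)).comp (measurable_cellIndex n)
  have hf (σ : Equiv.Perm (Fin k)) := tendsto_real_of_isOrderInvariant hG hz hlim hU
    (measurableSet_patternEvent σ) (isOrderInvariant_patternEvent σ)
  have hle (n : ℕ) (σ : Equiv.Perm (Fin k)) : (Measure.pi fun _ : Fin k =>
      P.map (z n ∘ cellIndex n)).real (patternEvent σ) ≤ permDensity σ (τ n) := by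
    rw [hPdef, real_pi_map_cellIndex (z n) (measurableSet_patternEvent σ)]
    exact hτ n k σ
  have hsum := Finset.add_sum_erase Finset.univ (fun σ => measureDensity σ (P.map G))
    (Finset.mem_univ π)
  rw [hU.sum_measureDensity k] at hsum
  -- The proportions are only lower bounds. Since the limit densities sum to 1 and the permutation
  -- densities to at most 1, the lower bounds for the other patterns give a matching upper bound for
  -- `π`.
  have hup : Tendsto (fun n => 1 - ∑ σ ∈ Finset.univ.erase π, (Measure.pi fun _ : Fin k =>
      P.map (z n ∘ cellIndex n)).real (patternEvent σ)) atTop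
      (𝓝 (measureDensity π (P.map G))) := by
    rw [← eq_sub_iff_add_eq] at hsum
    rw [hsum]
    exact tendsto_const_nhds.sub (tendsto_finsetSum _ fun σ _ => hf σ)
  refine tendsto_of_tendsto_of_tendsto_of_le_of_le (hf π) hup (fun n => hle n π) (fun n => ?_)
  have h1 := Finset.add_sum_erase Finset.univ (fun σ => permDensity σ (τ n)) (Finset.mem_univ π)
  have h2 := sum_permDensity_le_one (k := k) (τ n)
  have h3 := Finset.sum_le_sum fun σ (_ : σ ∈ Finset.univ.erase π) => hle n σ
  simp only at h1 ⊢
  linarith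

/-! ### Length in the plane -/

/-- The identification of the Euclidean plane with `ℝ × ℝ`. -/
noncomputable def planeEquiv : EuclideanSpace ℝ (Fin 2) ≃ᵐ ℝ × ℝ :=
  (MeasurableEquiv.toLp 2 (Fin 2 → ℝ)).symm.trans MeasurableEquiv.finTwoArrow

theorem planeEquiv_apply (p : EuclideanSpace ℝ (Fin 2)) : planeEquiv p = (p 0, p 1) := rfl

theorem planeEquiv_symm_apply (q : ℝ × ℝ) : planeEquiv.symm q = !₂[q.1, q.2] := by
  rw [MeasurableEquiv.symm_apply_eq, planeEquiv_apply]
  simp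

theorem planeLength_eq : planeLength = (Measure.hausdorffMeasure 1).map planeEquiv := rfl

theorem planeLength_apply (s : Set (ℝ × ℝ)) :
    planeLength s = Measure.hausdorffMeasure 1 (planeEquiv.symm '' s) := by
  rw [planeLength_eq, MeasurableEquiv.map_apply, MeasurableEquiv.image_symm]

theorem planeLength_of_countable {s : Set (ℝ × ℝ)} (hs : s.Countable) : planeLength s = 0 := by
  have : NullSingletonClass (Measure.hausdorffMeasure 1 : Measure (EuclideanSpace ℝ (Fin 2))) :=
    Measure.nullSingletonClass_hausdorff _ one_pos
  rw [planeLength_apply]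
  exact (hs.image _).measure_zero _

/-- Under each alternative the difference vector changes at most by a sign or by exchanging its
entries, which preserves Euclidean length; a surjective isometry preserves Hausdorff measure. -/
theorem planeLength_map_of_isometry {R : ℝ × ℝ → ℝ × ℝ} (hR : Measurable R)
    (hinv : Function.Involutive R)
    (hiso : ∀ p q : ℝ × ℝ, (R p).1 - (R q).1 = p.1 - q.1 ∧ (R p).2 - (R q).2 = p.2 - q.2 ∨
      (R p).1 - (R q).1 = q.1 - p.1 ∧ (R p).2 - (R q).2 = p.2 - q.2 ∨
      (R p).1 - (R q).1 = p.2 - q.2 ∧ (R p).2 - (R q).2 = p.1 - q.1) :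
    planeLength.map R = planeLength := by
  let f : EuclideanSpace ℝ (Fin 2) → EuclideanSpace ℝ (Fin 2) :=
    fun p => planeEquiv.symm (R (planeEquiv p))
  have hf : Isometry f := by
    refine Isometry.of_dist_eq fun p q => ?_
    simp only [f, planeEquiv_symm_apply, EuclideanSpace.dist_eq, Fin.sum_univ_two,
      planeEquiv_apply, Real.dist_eq, sq_abs]
    congr 1
    simp only [Matrix.cons_val_zero, Matrix.cons_val_one]
    rcases hiso (p 0, p 1) (q 0, q 1) with ⟨h1, h2⟩ | ⟨h1, h2⟩ | ⟨h1, h2⟩ <;> rw [h1, h2]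
    · ring
    · ring
  have hs : Function.Surjective f := fun p => ⟨f p, by simp [f, hinv _]⟩
  have h1 := hf.map_hausdorffMeasure (d := 1) (Or.inl zero_le_one)
  rw [hs.range_eq, Measure.restrict_univ] at h1
  rw [planeLength_eq, Measure.map_map hR planeEquiv.measurable]
  conv_rhs => rw [← h1, Measure.map_map planeEquiv.measurable hf.continuous.measurable]
  congr 1

-- Arc length parametrization: t ↦ (t/√2, e·t/√2 + d) is isometric when e² = 1, and the image of B
-- is its image of √2 • B.
open scoped Pointwise in
theorem planeLength_image_line {e : ℝ} (he : e ^ 2 = 1) (d : ℝ) (B : Set ℝ) :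
    planeLength ((fun x => (x, e * x + d)) '' B) = ENNReal.ofReal √2 * volume B := by
  let h : ℝ → EuclideanSpace ℝ (Fin 2) := fun t => !₂[t / √2, e * (t / √2) + d]
  have h2 : √2 ^ 2 = 2 := Real.sq_sqrt (by norm_num)
  have h20 : √2 ≠ 0 := by positivity
  have hh : Isometry h := by
    refine Isometry.of_dist_eq fun s t => ?_
    simp only [h, EuclideanSpace.dist_eq, Fin.sum_univ_two, Real.dist_eq, sq_abs,
      Matrix.cons_val_zero, Matrix.cons_val_one]
    rw [← Real.sqrt_sq_eq_abs]
    congr 1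
    have : (s / √2 - t / √2) ^ 2 + (e * (s / √2) + d - (e * (t / √2) + d)) ^ 2 =
        (s - t) ^ 2 / √2 ^ 2 * (1 + e ^ 2) := by field_simp; ring
    rw [this, h2, he]; ring
  rw [planeLength_apply, image_image]
  have : (fun x => planeEquiv.symm (x, e * x + d)) '' B = h '' (√2 • B) := by
    rw [← image_smul, image_image]
    refine image_congr fun x _ => ?_
    simp [h, planeEquiv_symm_apply, h20]
  rw [this, hh.hausdorffMeasure_image (Or.inl zero_le_one), hausdorffMeasure_real,
    Measure.addHaar_smul]
  simp [abs_of_nonneg]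

/-! ### Closed geodesics of slope `±1` on the torus -/

/-- Parametrization of the line of slope `e` through `(0, d)`, reduced modulo `1`. -/
noncomputable def torusLine (e d x : ℝ) : ℝ × ℝ := (x, Int.fract (e * x + d))

theorem measurable_torusLine (e d : ℝ) : Measurable (torusLine e d) := by
  unfold torusLine
  fun_prop

theorem torusLine_injective (e d : ℝ) : Function.Injective (torusLine e d) :=
  fun _ _ h => congrArg Prod.fst h

/-- On the part of `B` where the floor of e·x + d is a fixed n, the geodesic is an ordinary line;
lengths of the pieces add up. -/
theorem planeLength_image_torusLine {e : ℝ} (he : e ^ 2 = 1) (d : ℝ) {B : Set ℝ}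
    (hB : MeasurableSet B) :
    planeLength (torusLine e d '' B) = ENNReal.ofReal √2 * volume B := by
  have hA (n : ℤ) : MeasurableSet (B ∩ {x | ⌊e * x + d⌋ = n}) := by
    refine hB.inter (measurableSet_eq_fun ?_ measurable_const)
    fun_prop
  have hAd : Pairwise (Function.onFun Disjoint fun n : ℤ => B ∩ {x | ⌊e * x + d⌋ = n}) :=
    fun m n hmn => disjoint_left.2 fun x hx hx' => hmn (hx.2.symm.trans hx'.2)
  have hBU : B = ⋃ n : ℤ, B ∩ {x | ⌊e * x + d⌋ = n} := by
    ext x; simp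
  have himg (n : ℤ) : torusLine e d '' (B ∩ {x | ⌊e * x + d⌋ = n}) =
      (fun x => (x, e * x + (d - n))) '' (B ∩ {x | ⌊e * x + d⌋ = n}) := by
    refine image_congr fun x hx => ?_
    have : ⌊e * x + d⌋ = n := hx.2
    simp only [torusLine, Int.fract, this]
    ring_nf
  have hme (d' : ℝ) : MeasurableEmbedding fun x : ℝ => (x, e * x + d') :=
    Continuous.measurableEmbedding (by fun_prop) fun _ _ h => congrArg Prod.fst h
  rw [hBU, image_iUnion, measure_iUnion _ (fun n => ?_), measure_iUnion hAd hA,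
    ← ENNReal.tsum_mul_left]
  · exact tsum_congr fun n => by rw [himg, planeLength_image_line he]
  · exact fun m n hmn => (disjoint_image_iff (torusLine_injective e d)).2 (hAd hmn)
  · rw [himg]
    exact (hme _).measurableSet_image.2 (hA n)

theorem measurableSet_image_torusLine (e d : ℝ) {B : Set ℝ} (hB : MeasurableSet B) :
    MeasurableSet (torusLine e d '' B) := by
  have : torusLine e d '' B = {p : ℝ × ℝ | p.1 ∈ B} ∩ {p | p.2 = Int.fract (e * p.1 + d)} := by
    ext ⟨x, y⟩
    simp [torusLine, eq_comm]
  rw [this]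
  exact (measurable_fst hB).inter (measurableSet_eq_fun (by fun_prop) (by fun_prop))

/-- Length on a geodesic of the torus is a multiple of the push-forward of Lebesgue measure. -/
theorem planeLength_restrict_torusLine {e : ℝ} (he : e ^ 2 = 1) (d : ℝ) :
    planeLength.restrict (torusLine e d '' Ico 0 1) =
      ENNReal.ofReal √2 • (volume.restrict (Ico 0 1)).map (torusLine e d) := by
  ext S hS
  have hm := measurable_torusLine e d
  rw [Measure.restrict_apply hS, Measure.smul_apply, Measure.map_apply hm hS,
    Measure.restrict_apply (hm hS), smul_eq_mul,
    ← planeLength_image_torusLine he d ((hm hS).inter measurableSet_Ico), image_preimage_inter]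

/-- The sign attached to a boolean. -/
def boolSign (b : Bool) : ℝ := cond b 1 (-1)

theorem boolSign_sq (b : Bool) : boolSign b ^ 2 = 1 := by cases b <;> simp [boolSign]

/-- The four geodesics that make up `M(a)`. -/
noncomputable def segmentLine (a : ℝ) (i : Bool × Bool) : ℝ → ℝ × ℝ :=
  torusLine (boolSign i.1) (boolSign i.2 * (a / 2))

theorem measurable_segmentLine (a : ℝ) (i : Bool × Bool) : Measurable (segmentLine a i) :=
  measurable_torusLine _ _

/-- The eight lines in the definition represent the four congruences y ≡ ±x ± a/2 modulo 1; on the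
half-open square the bounds on the coordinates leave only finitely many integers to check. -/
theorem mem_segmentSet_iff {a : ℝ} (ha : a ∈ Icc (0 : ℝ) 1) {p : ℝ × ℝ}
    (h1 : p.1 ∈ Ico (0 : ℝ) 1) (h2 : p.2 ∈ Ico (0 : ℝ) 1) :
    p ∈ segmentSet a ↔ ∃ i, segmentLine a i p.1 = p := by
  obtain ⟨x, y⟩ := p
  obtain ⟨a0, a1⟩ := ha
  obtain ⟨x0, x1⟩ := h1
  obtain ⟨y0, y1⟩ := h2
  simp only at x0 x1 y0 y1
  have hsq : (x, y) ∈ unitSquare := ⟨⟨x0, x1.le⟩, ⟨y0, y1.le⟩⟩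
  have key (i : Bool × Bool) : segmentLine a i x = (x, y) ↔
      ∃ n : ℤ, boolSign i.1 * x + boolSign i.2 * (a / 2) - y = n := by
    simp only [segmentLine, torusLine, Prod.mk.injEq, true_and]
    rw [Int.fract_eq_iff]
    exact ⟨fun h => h.2.2, fun h => ⟨y0, y1, h⟩⟩
  simp only [key, segmentSet, mem_ofPred_eq, hsq, true_and, mem_insert_iff, mem_singleton_iff]
  constructor
  · rintro ((h | h | h | h) | (h | h | h | h))
    · exact ⟨(false, false), -1, by simp [boolSign]; linarith⟩
    · exact ⟨(false, true), -1, by simp [boolSign]; linarith⟩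
    · exact ⟨(false, true), 0, by simp [boolSign]; linarith⟩
    · exact ⟨(false, false), -2, by simp [boolSign]; linarith⟩
    · exact ⟨(true, false), 0, by simp [boolSign]; linarith⟩
    · exact ⟨(true, true), 0, by simp [boolSign]; linarith⟩
    · exact ⟨(true, false), -1, by simp [boolSign]; linarith⟩
    · exact ⟨(true, true), 1, by simp [boolSign]; linarith⟩
  · rintro ⟨⟨_ | _, _ | _⟩, n, hn⟩
    · simp only [boolSign, cond_false] at hn
      have b1 : (-3 : ℝ) < n := by linarith
      have b2 : (n : ℝ) < 1 := by linarith
      have b1' : -3 < n := by exact_mod_cast b1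
      have b2' : n < 1 := by exact_mod_cast b2
      have : n = -2 ∨ n = -1 ∨ n = 0 := by omega
      rcases this with rfl | rfl | rfl <;> push_cast at hn
      · left; right; right; right; linarith
      · left; left; linarith
      -- Here x + y = -a/2, which forces x = y = a = 0, a point on the line x + y = a/2.
      · left; right; right; left; linarith
    · simp only [boolSign, cond_false, cond_true] at hn
      have b1 : (-2 : ℝ) < n := by linarith
      have b2 : (n : ℝ) < 1 := by linarith
      have b1' : -2 < n := by exact_mod_cast b1
      have b2' : n < 1 := by exact_mod_cast b2
      have : n = -1 ∨ n = 0 := by omega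
      rcases this with rfl | rfl <;> push_cast at hn
      · left; right; left; linarith
      · left; right; right; left; linarith
    · simp only [boolSign, cond_false, cond_true] at hn
      have b1 : (-2 : ℝ) < n := by linarith
      have b2 : (n : ℝ) < 1 := by linarith
      have b1' : -2 < n := by exact_mod_cast b1
      have b2' : n < 1 := by exact_mod_cast b2
      have : n = -1 ∨ n = 0 := by omega
      rcases this with rfl | rfl <;> push_cast at hn
      · right; right; right; left; linarith
      · right; left; linarith
    · simp only [boolSign, cond_true] at hn
      have b1 : (-1 : ℝ) < n := by linarith
      have b2 : (n : ℝ) < 2 := by linarith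
      have b1' : -1 < n := by exact_mod_cast b1
      have b2' : n < 2 := by exact_mod_cast b2
      have : n = 0 ∨ n = 1 := by omega
      rcases this with rfl | rfl <;> push_cast at hn
      · right; right; left; linarith
      · right; right; right; right; linarith

/-- The sets differ only on the edges x = 1 and y = 1, and there the other coordinate takes finitely
many values, collected in `F`. -/
theorem segmentSet_ae_eq {a : ℝ} (ha : a ∈ Icc (0 : ℝ) 1) :
    segmentSet a =ᵐ[planeLength] ⋃ i, segmentLine a i '' Ico 0 1 := by
  let F : Set ℝ := {-(a / 2), a / 2, a / 2 - 1, 1 - a / 2, 1 + a / 2, 2 - a / 2}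
  have hF : F.Countable := (toFinite F).countable
  have hC : (({1} ×ˢ F) ∪ (F ×ˢ {1}) : Set (ℝ × ℝ)).Countable :=
    ((countable_singleton 1).prod hF).union (hF.prod (countable_singleton 1))
  have h0 : ∀ᵐ p ∂planeLength, p ∉ (({1} ×ˢ F) ∪ (F ×ˢ {1}) : Set (ℝ × ℝ)) :=
    measure_eq_zero_iff_ae_notMem.1 (planeLength_of_countable hC)
  filter_upwards [h0] with p hp
  refine propext ⟨fun h => ?_, fun h => ?_⟩
  · have h : p ∈ segmentSet a := h
    obtain ⟨⟨⟨x0, x1⟩, ⟨y0, y1⟩⟩, hM⟩ := h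
    have hx : p.1 ≠ 1 := by
      intro hx
      refine hp (Or.inl ⟨hx, ?_⟩)
      simp only [hx, mem_insert_iff, mem_singleton_iff] at hM
      simp only [F, mem_insert_iff, mem_singleton_iff]
      rcases hM with (h | h | h | h) | (h | h | h | h)
      · left; linarith
      · right; left; linarith
      · right; right; left; linarith
      · right; right; right; left; linarith
      · right; right; right; left; linarith
      · right; right; right; right; left; linarith
      · right; right; right; right; right; linarith
      · right; left; linarith
    have hy : p.2 ≠ 1 := by
      intro hy
      refine hp (Or.inr ⟨?_, hy⟩)
      simp only [hy, mem_insert_iff, mem_singleton_iff] at hM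
      simp only [F, mem_insert_iff, mem_singleton_iff]
      rcases hM with (h | h | h | h) | (h | h | h | h)
      · left; linarith
      · right; left; linarith
      · right; right; left; linarith
      · right; right; right; left; linarith
      · right; right; right; right; left; linarith
      · right; right; right; left; linarith
      · right; left; linarith
      · right; right; right; right; right; linarith
    have hx' : p.1 ∈ Ico (0 : ℝ) 1 := ⟨x0, lt_of_le_of_ne x1 hx⟩
    obtain ⟨i, hi⟩ := (mem_segmentSet_iff ha hx' ⟨y0, lt_of_le_of_ne y1 hy⟩).1 ⟨⟨⟨x0, x1⟩, ⟨y0, y1⟩⟩, hM⟩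
    exact mem_iUnion.2 ⟨i, p.1, hx', hi⟩
  · obtain ⟨i, x, hx, hi⟩ := mem_iUnion.1 h
    have hpx : p.1 = x := by rw [← hi]; rfl
    refine (mem_segmentSet_iff ha (hpx ▸ hx) ?_).2 ⟨i, by rw [hpx, hi]⟩
    rw [← hi]
    exact ⟨Int.fract_nonneg _, Int.fract_lt_one _⟩

theorem countable_setOf_eq_intCast {e : ℝ} (he : e ≠ 0) (d : ℝ) :
    {x : ℝ | ∃ n : ℤ, e * x + d = n}.Countable := by
  refine (countable_range fun n : ℤ => ((n : ℝ) - d) / e).mono ?_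
  rintro x ⟨n, hn⟩
  exact ⟨n, by simp only; rw [← hn]; field_simp; ring⟩

theorem aedisjoint_torusLine {e d e' d' : ℝ}
    (h : {x | ∃ n : ℤ, (e - e') * x + (d - d') = n}.Countable) :
    AEDisjoint planeLength (torusLine e d '' Ico 0 1) (torusLine e' d' '' Ico 0 1) := by
  have hsub : torusLine e d '' Ico 0 1 ∩ torusLine e' d' '' Ico 0 1 ⊆ torusLine e d ''
      {x | ∃ n : ℤ, (e - e') * x + (d - d') = n} := by
    rintro p ⟨⟨x, hx, rfl⟩, ⟨y, hy, hxy⟩⟩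
    refine ⟨x, ?_, rfl⟩
    have h1 : y = x := congrArg Prod.fst hxy
    subst h1
    obtain ⟨n, hn⟩ := Int.fract_eq_fract.1 (congrArg Prod.snd hxy).symm
    exact ⟨n, by rw [← hn]; ring⟩
  exact measure_mono_null hsub (planeLength_of_countable (h.image _))

theorem aedisjoint_segmentLine_of_ne (a : ℝ) {i j : Bool × Bool} (h : i.1 ≠ j.1) :
    AEDisjoint planeLength (segmentLine a i '' Ico 0 1) (segmentLine a j '' Ico 0 1) := by
  refine aedisjoint_torusLine (countable_setOf_eq_intCast ?_ _)
  rcases i with ⟨_ | _, _⟩ <;> rcases j with ⟨_ | _, _⟩ <;> (simp [boolSign] at h ⊢; try norm_num)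

theorem aedisjoint_segmentLine {a : ℝ} (ha : a ∈ Ioo (0 : ℝ) 1) {i j : Bool × Bool} (hij : i ≠ j) :
    AEDisjoint planeLength (segmentLine a i '' Ico 0 1) (segmentLine a j '' Ico 0 1) := by
  by_cases h1 : i.1 = j.1
  · have h2 : i.2 ≠ j.2 := fun h2 => hij (Prod.ext h1 h2)
    -- Parallel geodesics are offset by ±a, which is not an integer for 0 < a < 1, so they never
    -- meet.
    refine aedisjoint_torusLine ?_
    convert countable_empty
    rw [eq_empty_iff_forall_notMem]
    rintro x ⟨n, hn⟩
    rw [h1, sub_self, zero_mul, zero_add] at hn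
    obtain ⟨a0, a1⟩ := ha
    have : (n : ℝ) = a ∨ (n : ℝ) = -a := by
      rcases i with ⟨_, _ | _⟩ <;> rcases j with ⟨_, _ | _⟩ <;> simp [boolSign] at hn h2 <;>
        [right; left] <;> linarith
    rcases this with h | h
    · have b1 : (0 : ℝ) < n := by linarith
      have b2 : (n : ℝ) < 1 := by linarith
      have b1' : 0 < n := by exact_mod_cast b1
      have b2' : n < 1 := by exact_mod_cast b2
      omega
    · have b1 : (-1 : ℝ) < n := by linarith
      have b2 : (n : ℝ) < 0 := by linarith
      have b1' : -1 < n := by exact_mod_cast b1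
      have b2' : n < 0 := by exact_mod_cast b2
      omega
  · exact aedisjoint_segmentLine_of_ne a h1

/-- Normalization cancels the length factor `c`, as the total mass is `c` times the number of
summands. -/
theorem smul_restrict_eq_of_sum {ι : Type*} [Fintype ι] [Nonempty ι] {α : Type*}
    [MeasurableSpace α] {κ : Measure α} {s : Set α} {c : ENNReal} (h0 : c ≠ 0) (ht : c ≠ ⊤)
    (ν : ι → Measure α) (hν : ∀ i, IsProbabilityMeasure (ν i))
    (h : κ.restrict s = c • ∑ i, ν i) :
    (κ s)⁻¹ • κ.restrict s = (Fintype.card ι : ENNReal)⁻¹ • ∑ i, ν i := by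
  have h1 : κ s = c * Fintype.card ι := by
    rw [← Measure.restrict_apply_univ, h]
    simp
  rw [h1, h, smul_smul, ENNReal.mul_inv (Or.inl h0) (Or.inl ht), mul_right_comm,
    ENNReal.inv_mul_cancel h0 ht, one_mul]

theorem isProbabilityMeasure_map_Ico {α : Type*} [MeasurableSpace α] {f : ℝ → α}
    (hf : Measurable f) : IsProbabilityMeasure ((volume.restrict (Ico (0 : ℝ) 1)).map f) := by
  have hP : IsProbabilityMeasure (volume.restrict (Ico (0 : ℝ) 1)) := ⟨by simp⟩
  exact Measure.isProbabilityMeasure_map hf.aemeasurable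

theorem segmentLine_false {a : ℝ} (ha : a = 0 ∨ a = 1) (ε : Bool) :
    segmentLine a (ε, false) = segmentLine a (ε, true) := by
  funext x
  simp only [segmentLine, torusLine, Prod.mk.injEq, true_and, boolSign, cond_true, cond_false]
  rw [Int.fract_eq_fract]
  rcases ha with rfl | rfl
  · exact ⟨0, by simp⟩
  · exact ⟨-1, by push_cast; ring⟩

/-- The measure `μ_a` is the average of the uniform measures on four geodesics. -/
theorem segmentMeasure_eq {a : ℝ} (ha : a ∈ Icc (0 : ℝ) 1) :
    segmentMeasure a = (4 : ENNReal)⁻¹ •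
      ∑ i, (volume.restrict (Ico (0 : ℝ) 1)).map (segmentLine a i) := by
  have h2 : ENNReal.ofReal √2 ≠ 0 := by simp
  have hres (i : Bool × Bool) : planeLength.restrict (segmentLine a i '' Ico 0 1) =
      ENNReal.ofReal √2 • (volume.restrict (Ico (0 : ℝ) 1)).map (segmentLine a i) :=
    planeLength_restrict_torusLine (boolSign_sq _) _
  have hmeas (i : Bool × Bool) : MeasurableSet (segmentLine a i '' Ico 0 1) :=
    measurableSet_image_torusLine _ _ measurableSet_Ico
  unfold segmentMeasure
  by_cases ha' : a ∈ Ioo (0 : ℝ) 1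
  · have hr : planeLength.restrict (segmentSet a) = ENNReal.ofReal √2 •
        ∑ i, (volume.restrict (Ico (0 : ℝ) 1)).map (segmentLine a i) := by
      rw [Measure.restrict_congr_set (segmentSet_ae_eq ha), Measure.restrict_iUnion_ae
        (fun i j hij => aedisjoint_segmentLine ha' hij) (fun i => (hmeas i).nullMeasurableSet),
        Measure.sum_fintype, Finset.smul_sum]
      simp_rw [hres]
    rw [smul_restrict_eq_of_sum h2 ENNReal.ofReal_ne_top _
      (fun i => isProbabilityMeasure_map_Ico (measurable_segmentLine a i)) hr]
    simp
  -- At the endpoints the geodesics coincide in pairs. M(a) then has half the length, and after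
  -- normalization averaging two geodesics is the same as averaging four with repetition.
  · have h01 : a = 0 ∨ a = 1 := by
      rcases ha.1.eq_or_lt with h | h
      · exact Or.inl h.symm
      · rcases ha.2.eq_or_lt with h' | h'
        · exact Or.inr h'
        · exact absurd ⟨h, h'⟩ ha'
    have hdeg := segmentLine_false h01
    have hU : (⋃ i, segmentLine a i '' Ico 0 1) = ⋃ ε : Bool, segmentLine a (ε, true) '' Ico 0 1 := by
      ext p
      simp only [mem_iUnion]
      constructor
      · rintro ⟨⟨ε, _ | _⟩, h⟩
        · exact ⟨ε, hdeg ε ▸ h⟩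
        · exact ⟨ε, h⟩
      · rintro ⟨ε, h⟩
        exact ⟨_, h⟩
    have hd : Pairwise (Function.onFun (AEDisjoint planeLength)
        fun ε : Bool => segmentLine a (ε, true) '' Ico 0 1) :=
       fun i j hij => aedisjoint_segmentLine_of_ne a hij
    have hr : planeLength.restrict (segmentSet a) = ENNReal.ofReal √2 •
        ∑ ε : Bool, (volume.restrict (Ico (0 : ℝ) 1)).map (segmentLine a (ε, true)) := by
      rw [Measure.restrict_congr_set (segmentSet_ae_eq ha), hU, Measure.restrict_iUnion_ae
        hd (fun i => (hmeas _).nullMeasurableSet),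
        Measure.sum_fintype, Finset.smul_sum]
      simp_rw [hres]
    rw [smul_restrict_eq_of_sum h2 ENNReal.ofReal_ne_top _
      (fun i => isProbabilityMeasure_map_Ico (measurable_segmentLine a _)) hr]
    rw [Fintype.sum_prod_type]
    simp only [Fintype.sum_bool, Fintype.card_bool, hdeg]
    rw [← two_smul ENNReal (Measure.map (segmentLine a (true, true)) _),
      ← two_smul ENNReal (Measure.map (segmentLine a (false, true)) _), ← smul_add, smul_smul]
    congr 1
    rw [show (4 : ENNReal) = 2 * 2 by norm_num, ENNReal.mul_inv (by simp) (by simp), mul_assoc,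
      ENNReal.inv_mul_cancel (by simp) (by simp), mul_one, Nat.cast_ofNat]

/-! ### Symmetries and marginals of `μ_a` -/

theorem segmentMeasure_map {a : ℝ} {R : ℝ × ℝ → ℝ × ℝ} (hR : Measurable R)
    (hinv : Function.Involutive R) (hlen : planeLength.map R = planeLength)
    (hM : R ⁻¹' segmentSet a = segmentSet a) : (segmentMeasure a).map R = segmentMeasure a := by
  have he : MeasurableEmbedding R :=
    (MeasurableEquiv.mk (hinv.toPerm R) hR hR).measurableEmbedding
  unfold segmentMeasure
  rw [Measure.map_smul]
  congr 1
  conv_lhs => rw [← hM]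
  rw [← he.restrict_map, hlen]

theorem segmentMeasure_map_swap (a : ℝ) :
    (segmentMeasure a).map Prod.swap = segmentMeasure a := by
  refine segmentMeasure_map measurable_swap Prod.swap_swap
    (planeLength_map_of_isometry measurable_swap Prod.swap_swap fun p q => ?_) ?_
  · exact Or.inr (Or.inr ⟨rfl, rfl⟩)
  · ext ⟨x, y⟩
    simp only [segmentSet, unitSquare, mem_preimage, mem_ofPred_eq, Prod.swap_prod_mk, mem_prod,
      mem_insert_iff, mem_singleton_iff]
    rw [add_comm y x, and_comm (a := y ∈ Icc (0 : ℝ) 1)]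
    refine and_congr_right fun _ => or_congr_right ?_
    constructor <;> rintro (h | h | h | h)
    · right; left; linarith
    · left; linarith
    · right; right; right; linarith
    · right; right; left; linarith
    · right; left; linarith
    · left; linarith
    · right; right; right; linarith
    · right; right; left; linarith

/-- Reflection of the plane in the line `x = 1/2`. -/
def reflectFst (p : ℝ × ℝ) : ℝ × ℝ := (1 - p.1, p.2)

theorem measurable_reflectFst : Measurable reflectFst := by unfold reflectFst; fun_prop

theorem involutive_reflectFst : Function.Involutive reflectFst := fun p => by simp [reflectFst]

theorem segmentMeasure_map_reflectFst (a : ℝ) :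
    (segmentMeasure a).map reflectFst = segmentMeasure a := by
  refine segmentMeasure_map measurable_reflectFst involutive_reflectFst
    (planeLength_map_of_isometry measurable_reflectFst involutive_reflectFst fun p q => ?_) ?_
  · exact Or.inr (Or.inl ⟨by simp [reflectFst], rfl⟩)
  · ext ⟨x, y⟩
    simp only [segmentSet, unitSquare, mem_preimage, mem_ofPred_eq, reflectFst, mem_prod,
      mem_insert_iff, mem_singleton_iff, mem_Icc]
    refine and_congr ?_ ?_
    · constructor <;> rintro ⟨⟨h1, h2⟩, h3, h4⟩ <;> refine ⟨⟨?_, ?_⟩, ?_, ?_⟩ <;> linarith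
    · constructor <;> rintro ((h | h | h | h) | (h | h | h | h))
      · right; left; linarith
      · right; right; left; linarith
      · right; right; right; right; linarith
      · right; right; right; left; linarith
      · left; left; linarith
      · left; right; left; linarith
      · left; right; right; right; linarith
      · left; right; right; left; linarith
      · right; left; linarith
      · right; right; left; linarith
      · right; right; right; right; linarith
      · right; right; right; left; linarith
      · left; left; linarith
      · left; right; left; linarith
      · left; right; right; right; linarith
      · left; right; right; left; linarith

theorem four_inv_smul_four {α : Type*} [MeasurableSpace α] (ν : Measure α) :
    (4 : ENNReal)⁻¹ • ∑ _i : Bool × Bool, ν = ν := by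
  rw [Finset.sum_const, Finset.card_univ, Fintype.card_prod, Fintype.card_bool,
    ← Nat.cast_smul_eq_nsmul ENNReal, smul_smul, Nat.cast_mul, Nat.cast_ofNat,
    show (2 : ENNReal) * 2 = 4 by norm_num, ENNReal.inv_mul_cancel (by simp) (by simp), one_smul]

theorem segmentMeasure_map_fst {a : ℝ} (ha : a ∈ Icc (0 : ℝ) 1) :
    (segmentMeasure a).map Prod.fst = volume.restrict (Icc 0 1) := by
  rw [segmentMeasure_eq ha, Measure.map_smul, ← Measure.mapₗ_apply_of_measurable measurable_fst,
    map_sum]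
  simp_rw [Measure.mapₗ_apply_of_measurable measurable_fst,
    Measure.map_map measurable_fst (measurable_segmentLine a _)]
  have (i : Bool × Bool) : Prod.fst ∘ segmentLine a i = id := rfl
  simp_rw [this, Measure.map_id]
  rw [four_inv_smul_four, restrict_Ico_eq_restrict_Icc]

theorem hasUniformMarginals_segmentMeasure {a : ℝ} (ha : a ∈ Icc (0 : ℝ) 1) :
    HasUniformMarginals (segmentMeasure a) := by
  have h1 := segmentMeasure_map_fst ha
  have hp : IsProbabilityMeasure (segmentMeasure a) := by
    have : IsProbabilityMeasure ((segmentMeasure a).map Prod.fst) := ⟨by rw [h1]; simp⟩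
    exact Measure.isProbabilityMeasure_of_map Prod.fst
  refine HasUniformMarginals.of_map_eq h1 ?_
  rw [← h1]
  conv_rhs => rw [← segmentMeasure_map_swap a]
  rw [Measure.map_map measurable_fst measurable_swap]
  rfl

/-- The measure is carried by four graphs, whose vertical sections are at most singletons, so this
carrier is Lebesgue-null. -/
theorem segmentMeasure_ne_uniformSquare {a : ℝ} (ha : a ∈ Icc (0 : ℝ) 1) :
    segmentMeasure a ≠ uniformSquare := by
  intro h
  have hp := (hasUniformMarginals_segmentMeasure ha).prob
  have hm (i : Bool × Bool) : MeasurableSet (segmentLine a i '' Ico 0 1) :=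
    measurableSet_image_torusLine _ _ measurableSet_Ico
  have hmU : MeasurableSet (⋃ i, segmentLine a i '' Ico 0 1) := MeasurableSet.iUnion hm
  have h0 : uniformSquare (⋃ i, segmentLine a i '' Ico 0 1) = 0 := by
    refine measure_iUnion_null fun i => ?_
    refine Measure.absolutelyContinuous_of_le Measure.restrict_le_self ?_
    rw [Measure.volume_eq_prod, Measure.measure_prod_null (hm i)]
    filter_upwards with x
    refine (countable_singleton (segmentLine a i x).2).mono ?_ |>.measure_zero _
    rintro y ⟨x', -, hx'⟩
    have : x' = x := congrArg Prod.fst hx'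
    rw [mem_singleton_iff, ← this, hx']
  have h1 : segmentMeasure a (⋃ i, segmentLine a i '' Ico 0 1)ᶜ = 0 := by
    have : planeLength.restrict (segmentSet a) (⋃ i, segmentLine a i '' Ico 0 1)ᶜ = 0 := by
      rw [Measure.restrict_congr_set (segmentSet_ae_eq ha), Measure.restrict_apply hmU.compl,
        compl_inter_self, measure_empty]
    unfold segmentMeasure
    rw [Measure.smul_apply, this, smul_zero]
  have h2 := prob_compl_eq_one_sub (μ := segmentMeasure a) hmU
  rw [h1, h, h0] at h2
  simp at h2

/-! ### `μ_a` as the law of a function on the unit interval -/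

/-- Run through `f` on `[0, 1/2)` and through `g` on `[1/2, 1)` at double speed. -/
noncomputable def splice {α : Type*} (f g : ℝ → α) (u : ℝ) : α :=
  if u < 1 / 2 then f (2 * u) else g (2 * u - 1)

theorem measurable_splice {α : Type*} [MeasurableSpace α] {f g : ℝ → α} (hf : Measurable f)
    (hg : Measurable g) : Measurable (splice f g) :=
  Measurable.ite measurableSet_Iio (hf.comp (by fun_prop)) (hg.comp (by fun_prop))

theorem volume_preimage_two_mul_sub (S : Set ℝ) (d : ℝ) :
    volume ((fun u => 2 * u - d) ⁻¹' S) = 2⁻¹ * volume S := by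
  have : (fun u : ℝ => 2 * u - d) ⁻¹' S = (fun u => 2 * u) ⁻¹' ((fun u => u + -d) ⁻¹' S) := by
    ext u; simp [sub_eq_add_neg]
  rw [this, Real.volume_preimage_mul_left two_ne_zero, measure_preimage_add_right]
  congr 1
  rw [abs_of_pos (by norm_num), ENNReal.ofReal_inv_of_pos two_pos]
  simp

theorem map_splice {α : Type*} [MeasurableSpace α] {f g : ℝ → α} (hf : Measurable f)
    (hg : Measurable g) :
    (volume.restrict (Ico (0 : ℝ) 1)).map (splice f g) = (2 : ENNReal)⁻¹ •
      ((volume.restrict (Ico (0 : ℝ) 1)).map f + (volume.restrict (Ico (0 : ℝ) 1)).map g) := by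
  have hm := measurable_splice hf hg
  ext S hS
  rw [Measure.map_apply hm hS, Measure.restrict_apply (hm hS), Measure.smul_apply,
    Measure.add_apply, Measure.map_apply hf hS, Measure.map_apply hg hS,
    Measure.restrict_apply (hf hS), Measure.restrict_apply (hg hS), smul_eq_mul, mul_add,
    ← volume_preimage_two_mul_sub _ 0, ← volume_preimage_two_mul_sub _ 1,
    ← measure_inter_add_sdiff _ (measurableSet_Iio (a := (1 / 2 : ℝ)))]
  congr 2
  · ext u
    simp only [mem_inter_iff, mem_preimage, mem_Iio, mem_Ico, splice, sub_zero]
    constructor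
    · rintro ⟨⟨h1, h2, h3⟩, h4⟩
      rw [if_pos h4] at h1
      exact ⟨h1, by linarith, by linarith⟩
    · rintro ⟨h1, h2, h3⟩
      have h4 : u < 1 / 2 := by linarith
      rw [if_pos h4]
      exact ⟨⟨h1, by linarith, by linarith⟩, h4⟩
  · ext u
    simp only [mem_inter_iff, mem_preimage, mem_Iio, mem_Ico, splice, Set.mem_sdiff]
    constructor
    · rintro ⟨⟨h1, h2, h3⟩, h4⟩
      rw [if_neg h4] at h1
      exact ⟨h1, by linarith, by linarith⟩
    · rintro ⟨h1, h2, h3⟩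
      have h4 : ¬ u < 1 / 2 := by linarith
      rw [if_neg h4]
      exact ⟨⟨h1, by linarith, by linarith⟩, h4⟩

theorem ae_splice {p q : ℝ → Prop} (hp : ∀ᵐ x ∂volume.restrict (Ico (0 : ℝ) 1), p x)
    (hq : ∀ᵐ x ∂volume.restrict (Ico (0 : ℝ) 1), q x) :
    ∀ᵐ u ∂volume.restrict (Ico (0 : ℝ) 1),
      u ≠ 1 / 2 ∧ (u < 1 / 2 → p (2 * u)) ∧ (1 / 2 < u → q (2 * u - 1)) := by
  -- The doubling map preserves Lebesgue measure, so pulling back along it keeps null sets null.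
  have h1 : (volume.restrict (Ico (0 : ℝ) 1)).map (splice id id) = volume.restrict (Ico 0 1) := by
    rw [map_splice measurable_id measurable_id, Measure.map_id, ← two_smul ENNReal, smul_smul,
      ENNReal.inv_mul_cancel (by simp) (by simp), one_smul]
  have h2 : ∀ᵐ u ∂volume.restrict (Ico (0 : ℝ) 1),
      p (splice id id u) ∧ q (splice id id u) := by
    refine ae_of_ae_map (p := fun x => p x ∧ q x)
      (measurable_splice measurable_id measurable_id).aemeasurable ?_
    rw [h1]
    exact hp.and hq
  have h3 : ∀ᵐ u ∂volume.restrict (Ico (0 : ℝ) 1), u ≠ 1 / 2 := by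
    rw [ae_iff]
    simp only [ne_eq, not_not]
    exact measure_singleton _
  filter_upwards [h2, h3] with u hu hne
  refine ⟨hne, fun h => ?_, fun h => ?_⟩
  · have := hu.1
    rwa [splice, if_pos h] at this
  · have := hu.2
    rwa [splice, if_neg h.not_gt] at this

theorem ae_continuousAt_splice {α : Type*} [TopologicalSpace α] {f g : ℝ → α}
    (hf : ∀ᵐ x ∂volume.restrict (Ico (0 : ℝ) 1), ContinuousAt f x)
    (hg : ∀ᵐ x ∂volume.restrict (Ico (0 : ℝ) 1), ContinuousAt g x) :
    ∀ᵐ u ∂volume.restrict (Ico (0 : ℝ) 1), ContinuousAt (splice f g) u := by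
  filter_upwards [ae_splice hf hg] with u ⟨hne, h1, h2⟩
  rcases lt_or_gt_of_ne hne with h | h
  · have : ContinuousAt (fun u => f (2 * u)) u :=
      ContinuousAt.comp (f := fun u : ℝ => 2 * u) (h1 h) (by fun_prop)
    refine this.congr ?_
    filter_upwards [Iio_mem_nhds h] with v hv
    exact (if_pos hv).symm
  · have : ContinuousAt (fun u => g (2 * u - 1)) u :=
      ContinuousAt.comp (f := fun u : ℝ => 2 * u - 1) (h2 h) (by fun_prop)
    refine this.congr ?_
    filter_upwards [Ioi_mem_nhds h] with v hv
    exact (if_neg (not_lt.2 (le_of_lt hv))).symm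

theorem ae_tendsto_splice {α ι : Type*} [TopologicalSpace α] {l : Filter ι} {f g : ℝ → α}
    {fn gn : ι → ℝ → α}
    (hf : ∀ᵐ x ∂volume.restrict (Ico (0 : ℝ) 1), Tendsto (fun n => fn n x) l (𝓝 (f x)))
    (hg : ∀ᵐ x ∂volume.restrict (Ico (0 : ℝ) 1), Tendsto (fun n => gn n x) l (𝓝 (g x))) :
    ∀ᵐ u ∂volume.restrict (Ico (0 : ℝ) 1),
      Tendsto (fun n => splice (fn n) (gn n) u) l (𝓝 (splice f g u)) := by
  filter_upwards [ae_splice hf hg] with u ⟨hne, h1, h2⟩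
  rcases lt_or_gt_of_ne hne with h | h
  · simpa only [splice, if_pos h] using h1 h
  · simpa only [splice, if_neg h.not_gt] using h2 h

/-- A function on `[0, 1)` with law `μ_a`. -/
noncomputable def segmentCurve (a : ℝ) : ℝ → ℝ × ℝ :=
  splice (splice (segmentLine a (true, true)) (segmentLine a (true, false)))
    (splice (segmentLine a (false, true)) (segmentLine a (false, false)))

theorem measurable_segmentCurve (a : ℝ) : Measurable (segmentCurve a) :=
  measurable_splice (measurable_splice (measurable_segmentLine _ _) (measurable_segmentLine _ _))
    (measurable_splice (measurable_segmentLine _ _) (measurable_segmentLine _ _))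

theorem map_segmentCurve {a : ℝ} (ha : a ∈ Icc (0 : ℝ) 1) :
    (volume.restrict (Ico (0 : ℝ) 1)).map (segmentCurve a) = segmentMeasure a := by
  have hm := measurable_segmentLine a
  rw [segmentCurve, map_splice (measurable_splice (hm _) (hm _)) (measurable_splice (hm _) (hm _)),
    map_splice (hm _) (hm _), map_splice (hm _) (hm _), segmentMeasure_eq ha,
    Fintype.sum_prod_type, ← smul_add, smul_smul]
  simp only [Fintype.sum_bool]
  congr 1
  rw [show (4 : ENNReal) = 2 * 2 by norm_num, ENNReal.mul_inv (by simp) (by simp)]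

theorem boolSign_ne_zero (b : Bool) : boolSign b ≠ 0 := by cases b <;> simp [boolSign]

theorem ae_segmentLine_ne_intCast (a : ℝ) (i : Bool × Bool) :
    ∀ᵐ x ∂volume.restrict (Ico (0 : ℝ) 1),
      ¬ ∃ n : ℤ, boolSign i.1 * x + boolSign i.2 * (a / 2) = n := by
  refine ae_restrict_of_ae ?_
  exact measure_eq_zero_iff_ae_notMem.1
    ((countable_setOf_eq_intCast (boolSign_ne_zero i.1) _).measure_zero volume)

theorem continuousAt_fract_of_not_exists {x : ℝ} (h : ¬ ∃ n : ℤ, x = n) :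
    ContinuousAt (Int.fract : ℝ → ℝ) x :=
  continuousAt_fract fun h' => h ⟨⌊x⌋, h'⟩

theorem ae_continuousAt_segmentLine (a : ℝ) (i : Bool × Bool) :
    ∀ᵐ x ∂volume.restrict (Ico (0 : ℝ) 1), ContinuousAt (segmentLine a i) x := by
  filter_upwards [ae_segmentLine_ne_intCast a i] with x hx
  exact continuousAt_id.prodMk (ContinuousAt.comp
    (f := fun x => boolSign i.1 * x + boolSign i.2 * (a / 2))
    (continuousAt_fract_of_not_exists hx) (by fun_prop))

/-- Continuity in the offset can fail only where `Int.fract` jumps, which for given a concerns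
countably many x. -/
theorem ae_tendsto_segmentLine (a : ℝ) (i : Bool × Bool) :
    ∀ᵐ x ∂volume.restrict (Ico (0 : ℝ) 1),
      Tendsto (fun b => segmentLine b i x) (𝓝 a) (𝓝 (segmentLine a i x)) := by
  filter_upwards [ae_segmentLine_ne_intCast a i] with x hx
  have : ContinuousAt (fun b => Int.fract (boolSign i.1 * x + boolSign i.2 * (b / 2))) a :=
    ContinuousAt.comp (f := fun b => boolSign i.1 * x + boolSign i.2 * (b / 2))
      (continuousAt_fract_of_not_exists hx) (by fun_prop)
  exact tendsto_const_nhds.prodMk_nhds this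

theorem ae_continuousAt_segmentCurve (a : ℝ) :
    ∀ᵐ u ∂volume.restrict (Ico (0 : ℝ) 1), ContinuousAt (segmentCurve a) u :=
  ae_continuousAt_splice
    (ae_continuousAt_splice (ae_continuousAt_segmentLine _ _) (ae_continuousAt_segmentLine _ _))
    (ae_continuousAt_splice (ae_continuousAt_segmentLine _ _) (ae_continuousAt_segmentLine _ _))

theorem ae_tendsto_segmentCurve (a : ℝ) :
    ∀ᵐ u ∂volume.restrict (Ico (0 : ℝ) 1),
      Tendsto (fun b => segmentCurve b u) (𝓝 a) (𝓝 (segmentCurve a u)) :=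
  ae_tendsto_splice
    (ae_tendsto_splice (ae_tendsto_segmentLine _ _) (ae_tendsto_segmentLine _ _))
    (ae_tendsto_splice (ae_tendsto_segmentLine _ _) (ae_tendsto_segmentLine _ _))

theorem exists_convergesToMeasure_segmentMeasure {a : ℝ} (ha : a ∈ Icc (0 : ℝ) 1) :
    ∃ (m : ℕ → ℕ) (τ : ∀ j, Equiv.Perm (Fin (m j))),
      ConvergesToMeasure m τ (segmentMeasure a) := by
  have := exists_convergesToMeasure (measurable_segmentCurve a) (ae_continuousAt_segmentCurve a)
  rw [map_segmentCurve ha] at this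
  exact this (hasUniformMarginals_segmentMeasure ha)

/-- The probability of an order invariant event depends continuously on `a`. -/
theorem continuousOn_real_pi_segmentMeasure {k : ℕ} {E : Set (Fin k → ℝ × ℝ)}
    (hEm : MeasurableSet E) (hE : IsOrderInvariant E) :
    ContinuousOn (fun a => (Measure.pi fun _ : Fin k => segmentMeasure a).real E) (Icc 0 1) := by
  have hP : IsProbabilityMeasure (volume.restrict (Ico (0 : ℝ) 1)) := ⟨by simp⟩
  intro a ha
  have h := tendsto_real_of_isOrderInvariant (measurable_segmentCurve a) measurable_segmentCurve
    (ae_tendsto_segmentCurve a)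
    (by rw [map_segmentCurve ha]; exact hasUniformMarginals_segmentMeasure ha) hEm hE
  rw [map_segmentCurve ha] at h
  refine (h.mono_left nhdsWithin_le_nhds).congr' ?_
  filter_upwards [self_mem_nhdsWithin] with b hb
  rw [map_segmentCurve hb]

/-! ### Densities of patterns of length three -/

theorem real_orderEvent_of_map_eq {μ : Measure (ℝ × ℝ)} [IsProbabilityMeasure μ]
    {R : ℝ × ℝ → ℝ × ℝ} (hR : Measurable R) (hμ : μ.map R = μ) {k : ℕ}
    {ρ σ ρ' σ' : Equiv.Perm (Fin k)}
    (h : ∀ v : Fin k → ℝ × ℝ, (fun i => R (v i)) ∈ orderEvent ρ σ ↔ v ∈ orderEvent ρ' σ') :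
    (Measure.pi fun _ : Fin k => μ).real (orderEvent ρ σ) =
      (Measure.pi fun _ : Fin k => μ).real (orderEvent ρ' σ') := by
  have := Measure.isProbabilityMeasure_map (μ := μ) hR.aemeasurable
  conv_lhs => rw [← hμ]
  rw [← Measure.pi_map_pi (fun _ => hR.aemeasurable),
    map_measureReal_apply (by fun_prop) (measurableSet_orderEvent _ _)]
  congr 1
  ext v
  exact h v

/-- Swapping the coordinates exchanges the two orders of a sample, which inverts its pattern. -/
theorem measureDensity_segmentMeasure_inv {a : ℝ} (ha : a ∈ Icc (0 : ℝ) 1) {k : ℕ}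
    (π : Equiv.Perm (Fin k)) :
    measureDensity π⁻¹ (segmentMeasure a) = measureDensity π (segmentMeasure a) := by
  have := (hasUniformMarginals_segmentMeasure ha).prob
  rw [measureDensity_eq π⁻¹ π, measureDensity_eq π 1, inv_mul_cancel, mul_one,
    real_orderEvent_of_map_eq (ρ' := 1) (σ' := π) measurable_swap (segmentMeasure_map_swap a)]
  intro v
  exact ⟨fun h i j => ⟨(h i j).2, (h i j).1⟩, fun h i j => ⟨(h i j).2, (h i j).1⟩⟩

/-- Reflecting the abscissas reverses the order in which the points are listed. -/
theorem measureDensity_segmentMeasure_mul_rev {a : ℝ} (ha : a ∈ Icc (0 : ℝ) 1) {k : ℕ}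
    (π : Equiv.Perm (Fin k)) :
    measureDensity (π * Fin.revPerm) (segmentMeasure a) = measureDensity π (segmentMeasure a) := by
  have := (hasUniformMarginals_segmentMeasure ha).prob
  rw [measureDensity_eq (π * Fin.revPerm) Fin.revPerm, measureDensity_eq π 1]
  rw [real_orderEvent_of_map_eq (ρ' := 1) (σ' := π * 1) measurable_reflectFst
    (segmentMeasure_map_reflectFst a)]
  intro v
  have hr : π * Fin.revPerm * Fin.revPerm = π * 1 := by
    rw [mul_assoc]; congr 1; ext i; simp
  rw [hr]
  constructor
  · intro h i j
    refine ⟨?_, (h i j).2⟩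
    have := (h j i).1
    simpa [reflectFst] using this
  · intro h i j
    refine ⟨?_, (h i j).2⟩
    have := (h j i).1
    simpa [reflectFst] using this

/-- The event that the second and the third point lie to the south-west of the first one. -/
def cornerEvent : Set (Fin 3 → ℝ × ℝ) :=
  {v | ((v 1).1 < (v 0).1 ∧ (v 2).1 < (v 0).1) ∧ ((v 1).2 < (v 0).2 ∧ (v 2).2 < (v 0).2)}

theorem measurableSet_cornerEvent : MeasurableSet cornerEvent := by
  simp only [cornerEvent, ofPred_and]
  refine MeasurableSet.inter (.inter ?_ ?_) (.inter ?_ ?_) <;>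
  exact measurableSet_lt (by fun_prop) (by fun_prop)

theorem isOrderInvariant_cornerEvent : IsOrderInvariant cornerEvent := by
  rintro v w h ⟨⟨h1, h2⟩, h3, h4⟩
  exact ⟨⟨(h _ _).1.1 h1, (h _ _).1.1 h2⟩, (h _ _).2.1 h3, (h _ _).2.1 h4⟩

theorem real_cornerEvent {μ : Measure (ℝ × ℝ)} [IsProbabilityMeasure μ] :
    (Measure.pi fun _ : Fin 3 => μ).real cornerEvent = ∫ z, cornerMass μ z ^ 2 ∂μ := by
  rw [real_pi_fin_succ measurableSet_cornerEvent]
  congr 1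
  ext z
  have := real_pi_univ_pi (μ := μ) ![Iio z.1 ×ˢ Iio z.2, Iio z.1 ×ˢ Iio z.2]
  simp only [Fin.prod_univ_two, Fin.forall_fin_succ] at this
  simp at this
  rw [sq, cornerMass, ← this]
  congr 1
  ext w
  simp [cornerEvent, Fin.cons]
  tauto

/-- The first point must be the topmost and rightmost, so the pattern is 123 or 213; each of the
three points is equally likely to play this role. -/
theorem HasUniformMarginals.real_cornerEvent_eq {μ : Measure (ℝ × ℝ)}
    (h : HasUniformMarginals μ) : (Measure.pi fun _ : Fin 3 => μ).real cornerEvent =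
      (measureDensity (1 : Equiv.Perm (Fin 3)) μ +
        measureDensity (Equiv.swap (0 : Fin 3) 1) μ) / 3 := by
  have h1 := h.real_eq_sum (E := cornerEvent)
    (fun ρ σ => (ρ 1 < ρ 0 ∧ ρ 2 < ρ 0) ∧ (σ 1 < σ 0 ∧ σ 2 < σ 0)) (fun ρ σ v hv => by
      simp only [cornerEvent, mem_ofPred_eq, (hv _ _).1, (hv _ _).2])
  rw [h1, ← Fintype.sum_prod_type' (f := fun ρ σ : Equiv.Perm (Fin 3) =>
    if (ρ 1 < ρ 0 ∧ ρ 2 < ρ 0) ∧ (σ 1 < σ 0 ∧ σ 2 < σ 0) then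
      measureDensity (σ * ρ⁻¹) μ / (Nat.factorial 3 : ℝ) else 0), ← Finset.sum_filter]
  -- `α` and `β` are the two permutations of `Fin 3` that send 0 to the maximum.
  let α : Equiv.Perm (Fin 3) := Equiv.swap 0 2
  let β : Equiv.Perm (Fin 3) := Equiv.swap 0 1 * Equiv.swap 0 2
  have hf : (Finset.univ.filter fun q : Equiv.Perm (Fin 3) × Equiv.Perm (Fin 3) =>
      (q.1 1 < q.1 0 ∧ q.1 2 < q.1 0) ∧ (q.2 1 < q.2 0 ∧ q.2 2 < q.2 0)) =
      {(α, α), (α, β), (β, α), (β, β)} := by decide +kernel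
  rw [hf, Finset.sum_insert (by decide), Finset.sum_insert (by decide),
    Finset.sum_insert (by decide), Finset.sum_singleton]
  have e1 : β * α⁻¹ = Equiv.swap 0 1 := by decide
  have e2 : α * β⁻¹ = Equiv.swap 0 1 := by decide
  simp only [e1, e2, mul_inv_cancel, Nat.factorial]
  push_cast
  ring

/-- The symmetries leave two unknowns, p for 123 and 321, q for the other four patterns. The total
2p + 4q = 1 and the hypothesis p + q = 1/3 give p = q = 1/6. -/
theorem isSymmetricOfOrder_three_of_real_cornerEvent {a : ℝ} (ha : a ∈ Icc (0 : ℝ) 1)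
    (h : (Measure.pi fun _ : Fin 3 => segmentMeasure a).real cornerEvent = 1 / 9) :
    IsSymmetricOfOrder 3 (segmentMeasure a) := by
  have hU := hasUniformMarginals_segmentMeasure ha
  set t : Equiv.Perm (Fin 3) → ℝ := fun π => measureDensity π (segmentMeasure a) with ht
  have hinv (π) : t π⁻¹ = t π := measureDensity_segmentMeasure_inv ha π
  have hrev (π) : t (π * Fin.revPerm) = t π := measureDensity_segmentMeasure_mul_rev ha π
  rw [hU.real_cornerEvent_eq] at h
  have hsum := hU.sum_measureDensity 3
  have huniv : (Finset.univ : Finset (Equiv.Perm (Fin 3))) =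
      {1, Fin.revPerm, Equiv.swap 0 1, Equiv.swap 0 1 * Fin.revPerm,
        (Equiv.swap 0 1 * Fin.revPerm)⁻¹, (Equiv.swap 0 1 * Fin.revPerm)⁻¹ * Fin.revPerm} := by
    decide
  rw [huniv, Finset.sum_insert (by decide), Finset.sum_insert (by decide),
    Finset.sum_insert (by decide), Finset.sum_insert (by decide),
    Finset.sum_insert (by decide), Finset.sum_singleton] at hsum
  have e1 := hrev 1
  have e2 := hrev (Equiv.swap 0 1)
  have e3 := hinv (Equiv.swap 0 1 * Fin.revPerm)
  have e4 := hrev (Equiv.swap 0 1 * Fin.revPerm)⁻¹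
  rw [one_mul] at e1
  have f1 : t 1 = 1 / 6 := by simp only [ht] at *; linarith
  have f2 : t (Equiv.swap 0 1) = 1 / 6 := by simp only [ht] at *; linarith
  intro π
  change t π = _
  have hπ : π ∈ (Finset.univ : Finset (Equiv.Perm (Fin 3))) := Finset.mem_univ π
  rw [huniv] at hπ
  simp only [Finset.mem_insert, Finset.mem_singleton] at hπ
  norm_num [Nat.factorial]
  rcases hπ with rfl | rfl | rfl | rfl | rfl | rfl <;> linarith

/-! ### The extreme cases `a = 0` and `a = 1` -/

/-- The area below level `y` of the part of the graph of `f` over `[0, x)`. -/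
noncomputable def graphMass (f : ℝ → ℝ) (x y : ℝ) : ℝ :=
  volume.real {u | u ∈ Ico (0 : ℝ) 1 ∧ u < x ∧ f u < y}

/-- The uniform measure on the union of the graphs of two functions on `[0, 1)`. -/
noncomputable def graphMeasure (f g : ℝ → ℝ) : Measure (ℝ × ℝ) :=
  (2 : ENNReal)⁻¹ • ((volume.restrict (Ico (0 : ℝ) 1)).map (fun u => (u, f u)) +
    (volume.restrict (Ico (0 : ℝ) 1)).map (fun u => (u, g u)))

theorem cornerMass_graphMeasure {f g : ℝ → ℝ} (hf : Measurable f) (hg : Measurable g)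
    (z : ℝ × ℝ) : cornerMass (graphMeasure f g) z =
      (graphMass f z.1 z.2 + graphMass g z.1 z.2) / 2 := by
  have hm {f : ℝ → ℝ} (hf : Measurable f) :
      ((volume.restrict (Ico (0 : ℝ) 1)).map (fun u => (u, f u))).real (Iio z.1 ×ˢ Iio z.2) =
        graphMass f z.1 z.2 := by
    rw [map_measureReal_apply (by fun_prop) (measurableSet_Iio.prod measurableSet_Iio),
      measureReal_restrict_apply (MeasurableSet.preimage
        (measurableSet_Iio.prod measurableSet_Iio) (by fun_prop)), inter_comm]
    rfl
  have := isProbabilityMeasure_map_Ico (f := fun u => (u, f u)) (by fun_prop)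
  have := isProbabilityMeasure_map_Ico (f := fun u => (u, g u)) (by fun_prop)
  rw [cornerMass, graphMeasure, measureReal_ennreal_smul_apply, measureReal_add_apply, hm hf, hm hg]
  simp
  ring

theorem integral_graphMeasure {f g : ℝ → ℝ} (hf : Measurable f) (hg : Measurable g)
    {h : ℝ × ℝ → ℝ} (hh : Measurable h) (hb : ∀ z, |h z| ≤ 1) :
    ∫ z, h z ∂graphMeasure f g =
      ((∫ u in Ico (0 : ℝ) 1, h (u, f u)) + ∫ u in Ico (0 : ℝ) 1, h (u, g u)) / 2 := by
  have := isProbabilityMeasure_map_Ico (f := fun u => (u, f u)) (by fun_prop)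
  have := isProbabilityMeasure_map_Ico (f := fun u => (u, g u)) (by fun_prop)
  rw [graphMeasure, integral_smul_measure, integral_add_measure
    (integrable_of_ae_abs_le hh (ae_of_all _ hb)) (integrable_of_ae_abs_le hh (ae_of_all _ hb)),
    integral_map (by fun_prop) hh.aestronglyMeasurable,
    integral_map (by fun_prop) hh.aestronglyMeasurable]
  simp
  ring


theorem graphMeasure_congr {f g f' g' : ℝ → ℝ} (s : Finset ℝ)
    (hf : ∀ u ∈ Ioo (0 : ℝ) 1, u ∉ s → f u = f' u)
    (hg : ∀ u ∈ Ioo (0 : ℝ) 1, u ∉ s → g u = g' u) : graphMeasure f g = graphMeasure f' g' := by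
  have key {f f' : ℝ → ℝ} (h : ∀ u ∈ Ioo (0 : ℝ) 1, u ∉ s → f u = f' u) :
      (volume.restrict (Ico (0 : ℝ) 1)).map (fun u => (u, f u)) =
        (volume.restrict (Ico (0 : ℝ) 1)).map (fun u => (u, f' u)) := by
    rw [← restrict_Ioo_eq_restrict_Ico]
    refine Measure.map_congr ?_
    filter_upwards [ae_restrict_mem measurableSet_Ioo, ae_restrict_of_ae
      (measure_eq_zero_iff_ae_notMem.1 (s.measure_zero volume))] with u hu hus
    rw [h u hu hus]
  rw [graphMeasure, graphMeasure, key hf, key hg]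

theorem segmentMeasure_eq_graphMeasure {a : ℝ} (ha : a = 0 ∨ a = 1) :
    segmentMeasure a =
      graphMeasure (fun u => Int.fract (u + a / 2)) (fun u => Int.fract (-u + a / 2)) := by
  have ha' : a ∈ Icc (0 : ℝ) 1 := by rcases ha with rfl | rfl <;> simp
  rw [segmentMeasure_eq ha', graphMeasure, Fintype.sum_prod_type]
  simp only [Fintype.sum_bool, segmentLine_false ha]
  rw [← two_smul ENNReal (Measure.map (segmentLine a (true, true)) _),
    ← two_smul ENNReal (Measure.map (segmentLine a (false, true)) _), ← smul_add, smul_smul]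
  rw [show (4 : ENNReal) = 2 * 2 by norm_num, ENNReal.mul_inv (by simp) (by simp), mul_assoc,
    ENNReal.inv_mul_cancel (by simp) (by simp), mul_one]
  have e1 : segmentLine a (true, true) = fun u => (u, Int.fract (u + a / 2)) := by
    funext u; simp [segmentLine, torusLine, boolSign]
  have e2 : segmentLine a (false, true) = fun u => (u, Int.fract (-u + a / 2)) := by
    funext u; simp [segmentLine, torusLine, boolSign]
  rw [e1, e2]

theorem fract_eq_of_sub_intCast {x y : ℝ} (n : ℤ) (h : x - y = n) (h0 : 0 ≤ y) (h1 : y < 1) :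
    Int.fract x = y :=
  Int.fract_eq_iff.2 ⟨h0, h1, n, h⟩

theorem segmentMeasure_zero :
    segmentMeasure 0 = graphMeasure (fun u => u) (fun u => 1 - u) := by
  rw [segmentMeasure_eq_graphMeasure (Or.inl rfl)]
  refine graphMeasure_congr ∅ (fun u hu _ => ?_) (fun u hu _ => ?_)
  · exact fract_eq_of_sub_intCast 0 (by simp) hu.1.le hu.2
  · exact fract_eq_of_sub_intCast (-1) (by push_cast; ring) (by linarith [hu.2]) (by linarith [hu.1])

theorem segmentMeasure_one : segmentMeasure 1 =
    graphMeasure (fun u => if u < 1 / 2 then u + 1 / 2 else u - 1 / 2)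
      (fun u => if u < 1 / 2 then 1 / 2 - u else 3 / 2 - u) := by
  rw [segmentMeasure_eq_graphMeasure (Or.inr rfl)]
  -- The point 1/2 is exceptional: there the second branch gives 1 while the fractional part is 0.
  refine graphMeasure_congr {1 / 2} (fun u hu _ => ?_) (fun u hu h2 => ?_)
  · obtain ⟨h0, h1⟩ := hu
    split_ifs with h
    · exact fract_eq_of_sub_intCast 0 (by simp) (by linarith) (by linarith)
    · exact fract_eq_of_sub_intCast 1 (by push_cast; ring) (by linarith) (by linarith)
  · obtain ⟨h0, h1⟩ := hu
    split_ifs with h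
    · exact fract_eq_of_sub_intCast 0 (by push_cast; ring) (by linarith) (by linarith)
    · have : 1 / 2 < u := lt_of_le_of_ne (not_lt.1 h) fun h' => h2 (by simp [← h'])
      exact fract_eq_of_sub_intCast (-1) (by push_cast; ring) (by linarith) (by linarith)

theorem integral_le_integral_Ico {F p q : ℝ → ℝ} (hF : Measurable F) (hb : ∀ u, |F u| ≤ 1)
    (hp : Continuous p) (hq : Continuous q) (h1 : ∀ u ∈ Ico (0 : ℝ) (1 / 2), p u ≤ F u)
    (h2 : ∀ u ∈ Ico (1 / 2 : ℝ) 1, q u ≤ F u) :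
    (∫ u in (0 : ℝ)..(1 / 2), p u) + (∫ u in (1 / 2 : ℝ)..1, q u) ≤
      ∫ u in Ico (0 : ℝ) 1, F u := by
  have hFi (s t : ℝ) : IntegrableOn F (Ico s t) := integrable_of_ae_abs_le hF (ae_of_all _ hb)
  have hi {r : ℝ → ℝ} (hr : Continuous r) (s t : ℝ) : IntegrableOn r (Ico s t) :=
    (hr.integrableOn_Icc).mono_set Ico_subset_Icc_self
  have hU : Ico (0 : ℝ) 1 = Ico 0 (1 / 2) ∪ Ico (1 / 2) 1 :=
    (Ico_union_Ico_eq_Ico (by norm_num) (by norm_num)).symm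
  rw [hU, setIntegral_union (by
    rw [disjoint_left]; intro u hu hu'; linarith [hu.2, hu'.1]) measurableSet_Ico (hFi _ _) (hFi _ _),
    intervalIntegral.integral_of_le (by norm_num), intervalIntegral.integral_of_le (by norm_num),
    ← integral_Ico_eq_integral_Ioc, ← integral_Ico_eq_integral_Ioc]
  exact add_le_add (setIntegral_mono_on (hi hp _ _) (hFi _ _) measurableSet_Ico h1)
    (setIntegral_mono_on (hi hq _ _) (hFi _ _) measurableSet_Ico h2)

theorem integral_Ico_le_integral {F p q : ℝ → ℝ} (hF : Measurable F) (hb : ∀ u, |F u| ≤ 1)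
    (hp : Continuous p) (hq : Continuous q) (h1 : ∀ u ∈ Ico (0 : ℝ) (1 / 2), F u ≤ p u)
    (h2 : ∀ u ∈ Ico (1 / 2 : ℝ) 1, F u ≤ q u) :
    ∫ u in Ico (0 : ℝ) 1, F u ≤
      (∫ u in (0 : ℝ)..(1 / 2), p u) + (∫ u in (1 / 2 : ℝ)..1, q u) := by
  have := integral_le_integral_Ico hF.neg (fun u => by simpa using hb u) hp.neg hq.neg
    (fun u hu => neg_le_neg (h1 u hu)) (fun u hu => neg_le_neg (h2 u hu))
  simp only [Pi.neg_apply, intervalIntegral.integral_neg, integral_neg] at this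
  linarith

theorem graphMass_nonneg (f : ℝ → ℝ) (x y : ℝ) : 0 ≤ graphMass f x y := measureReal_nonneg

theorem le_graphMass {f : ℝ → ℝ} {x y s t : ℝ} (hst : s ≤ t)
    (h : ∀ u ∈ Ioo s t, u ∈ Ico (0 : ℝ) 1 ∧ u < x ∧ f u < y) : t - s ≤ graphMass f x y := by
  rw [← Real.volume_real_Ioo_of_le hst]
  exact measureReal_mono h (measure_ne_top_of_subset (fun u hu => hu.1)
    (measure_Ico_lt_top (μ := volume) (a := (0 : ℝ)) (b := 1)).ne)

theorem graphMass_le_add {f : ℝ → ℝ} {x y s t s' t' : ℝ} (hst : s ≤ t) (hst' : s' ≤ t')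
    (h : ∀ u ∈ Ico (0 : ℝ) 1, u < x → f u < y → u ∈ Icc s t ∪ Icc s' t') :
    graphMass f x y ≤ (t - s) + (t' - s') := by
  rw [← Real.volume_real_Icc_of_le hst, ← Real.volume_real_Icc_of_le hst']
  exact (measureReal_mono (fun u hu => h u hu.1 hu.2.1 hu.2.2)
    (measure_union_lt_top measure_Icc_lt_top measure_Icc_lt_top).ne).trans
    (measureReal_union_le _ _)

theorem graphMass_le {f : ℝ → ℝ} {x y s t : ℝ} (hst : s ≤ t)
    (h : ∀ u ∈ Ico (0 : ℝ) 1, u < x → f u < y → u ∈ Icc s t) :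
    graphMass f x y ≤ t - s := by
  simpa using graphMass_le_add hst (le_refl (0 : ℝ)) fun u h0 h1 h2 => Or.inl (h u h0 h1 h2)

theorem abs_sq_cornerMass_le_one {μ : Measure (ℝ × ℝ)} [IsProbabilityMeasure μ] (z : ℝ × ℝ) :
    |cornerMass μ z ^ 2| ≤ 1 := by
  rw [abs_pow]
  exact pow_le_one₀ (abs_nonneg _) (abs_cornerMass_le_one z)

/-- On the two diagonals of the square, bounding the corner mass from below on each half of [0,1)
gives at least (1/96 + 7/32 + 1/96 + 1/96)/2 = 1/8. -/
theorem one_ninth_lt_real_cornerEvent :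
    1 / 9 < (Measure.pi fun _ : Fin 3 => segmentMeasure 0).real cornerEvent := by
  have := (hasUniformMarginals_segmentMeasure (a := 0) (by simp)).prob
  have hm : Measurable (fun z => cornerMass (segmentMeasure 0) z ^ 2) :=
    measurable_cornerMass.pow_const 2
  rw [real_cornerEvent]
  have hF (z : ℝ × ℝ) : cornerMass (segmentMeasure 0) z =
      (graphMass (fun u => u) z.1 z.2 + graphMass (fun u => 1 - u) z.1 z.2) / 2 := by
    rw [segmentMeasure_zero]; exact cornerMass_graphMeasure (by fun_prop) (by fun_prop) z
  have hI := integral_graphMeasure (f := fun u => u) (g := fun u => 1 - u) (by fun_prop)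
    (by fun_prop) hm abs_sq_cornerMass_le_one
  rw [← segmentMeasure_zero] at hI
  have i1 := integral_le_integral_Ico (F := fun u => cornerMass (segmentMeasure 0) (u, u) ^ 2)
    (p := fun u => (u / 2) ^ 2) (q := fun u => ((3 * u - 1) / 2) ^ 2)
    (hm.comp (by fun_prop)) (fun u => abs_sq_cornerMass_le_one _) (by fun_prop) (by fun_prop)
    (fun u hu => by
      have := le_graphMass (f := fun u => u) (x := u) (y := u) hu.1 (fun v hv =>
        ⟨⟨hv.1.le, by linarith [hv.2, hu.2]⟩, hv.2, hv.2⟩)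
      have h0 := graphMass_nonneg (fun u => 1 - u) u u
      simp only [hF]
      exact pow_le_pow_left₀ (by linarith [hu.1]) (by linarith) 2)
    (fun u hu => by
      have := le_graphMass (f := fun u => u) (x := u) (y := u) (s := 0) (t := u)
        (by linarith [hu.1]) (fun v hv => ⟨⟨hv.1.le, by linarith [hv.2, hu.2]⟩, hv.2, hv.2⟩)
      have h0 := le_graphMass (f := fun u => 1 - u) (x := u) (y := u) (s := 1 - u) (t := u)
        (by linarith [hu.1]) (fun v hv =>
          ⟨⟨by linarith [hv.1, hu.2], by linarith [hv.2, hu.2]⟩, hv.2, by linarith [hv.1]⟩)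
      simp only [hF]
      exact pow_le_pow_left₀ (by linarith [hu.1]) (by linarith) 2)
  have i2 := integral_le_integral_Ico (F := fun u => cornerMass (segmentMeasure 0) (u, 1 - u) ^ 2)
    (p := fun u => (u / 2) ^ 2) (q := fun u => ((1 - u) / 2) ^ 2)
    (hm.comp (by fun_prop)) (fun u => abs_sq_cornerMass_le_one _) (by fun_prop) (by fun_prop)
    (fun u hu => by
      have := le_graphMass (f := fun u => u) (x := u) (y := 1 - u) hu.1 (fun v hv =>
        ⟨⟨hv.1.le, by linarith [hv.2, hu.2]⟩, hv.2, by linarith [hv.2, hu.2]⟩)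
      have h0 := graphMass_nonneg (fun u => 1 - u) u (1 - u)
      simp only [hF]
      exact pow_le_pow_left₀ (by linarith [hu.1]) (by linarith) 2)
    (fun u hu => by
      have := le_graphMass (f := fun u => u) (x := u) (y := 1 - u) (s := 0) (t := 1 - u)
        (by linarith [hu.2]) (fun v hv =>
          ⟨⟨hv.1.le, by linarith [hv.2, hu.1]⟩, by linarith [hv.2, hu.1], hv.2⟩)
      have h0 := graphMass_nonneg (fun u => 1 - u) u (1 - u)
      simp only [hF]
      exact pow_le_pow_left₀ (by linarith [hu.2]) (by linarith) 2)
  have e1 : ∫ u in (0 : ℝ)..(1 / 2), (u / 2) ^ 2 = 1 / 96 := by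
    simp only [div_pow, intervalIntegral.integral_div, integral_pow]; norm_num
  have e2 : ∫ u in (1 / 2 : ℝ)..1, ((3 * u - 1) / 2) ^ 2 = 7 / 32 := by
    simp only [div_pow, intervalIntegral.integral_div]
    rw [intervalIntegral.integral_comp_mul_sub (fun u => u ^ 2) (by norm_num : (3 : ℝ) ≠ 0) 1,
      integral_pow]
    norm_num
  have e3 : ∫ u in (1 / 2 : ℝ)..1, ((1 - u) / 2) ^ 2 = 1 / 96 := by
    simp only [div_pow, intervalIntegral.integral_div]
    rw [intervalIntegral.integral_comp_sub_left (fun u => u ^ 2) 1, integral_pow]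
    norm_num
  rw [hI]
  rw [e1, e2] at i1
  rw [e1, e3] at i2
  linarith

/-- M(1) is the diamond through the midpoints of the sides. Bounding the corner mass from above on
its four edges gives at most (1/24 + 1/24 + 0 + 1/8)/2 = 5/48. -/
theorem real_cornerEvent_lt_one_ninth :
    (Measure.pi fun _ : Fin 3 => segmentMeasure 1).real cornerEvent < 1 / 9 := by
  have := (hasUniformMarginals_segmentMeasure (a := 1) (by simp)).prob
  have hm : Measurable (fun z => cornerMass (segmentMeasure 1) z ^ 2) :=
    measurable_cornerMass.pow_const 2
  rw [real_cornerEvent]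
  set f : ℝ → ℝ := fun u => if u < 1 / 2 then u + 1 / 2 else u - 1 / 2 with hf
  set g : ℝ → ℝ := fun u => if u < 1 / 2 then 1 / 2 - u else 3 / 2 - u with hg
  have f1 {u : ℝ} (hu : u < 1 / 2) : f u = u + 1 / 2 := if_pos hu
  have f2 {u : ℝ} (hu : 1 / 2 ≤ u) : f u = u - 1 / 2 := if_neg hu.not_gt
  have g1 {u : ℝ} (hu : u < 1 / 2) : g u = 1 / 2 - u := if_pos hu
  have g2 {u : ℝ} (hu : 1 / 2 ≤ u) : g u = 3 / 2 - u := if_neg hu.not_gt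
  have hfm : Measurable f := Measurable.ite measurableSet_Iio (by fun_prop) (by fun_prop)
  have hgm : Measurable g := Measurable.ite measurableSet_Iio (by fun_prop) (by fun_prop)
  have h1 : segmentMeasure 1 = graphMeasure f g := segmentMeasure_one
  have hF (z : ℝ × ℝ) : cornerMass (segmentMeasure 1) z =
      (graphMass f z.1 z.2 + graphMass g z.1 z.2) / 2 := by
    rw [h1]; exact cornerMass_graphMeasure hfm hgm z
  have hI := integral_graphMeasure hfm hgm hm abs_sq_cornerMass_le_one
  rw [← h1] at hI
  have i1 := integral_Ico_le_integral (F := fun u => cornerMass (segmentMeasure 1) (u, f u) ^ 2)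
    (p := fun u => u ^ 2) (q := fun u => (u - 1 / 2) ^ 2)
    (hm.comp (by fun_prop)) (fun u => abs_sq_cornerMass_le_one _) (by fun_prop) (by fun_prop)
    (fun u hu => by
      refine pow_le_pow_left₀ (cornerMass_nonneg _) ?_ 2
      have a1 := graphMass_le (f := f) (x := u) (y := f u) hu.1 (fun v hv h _ => ⟨hv.1, h.le⟩)
      have a2 := graphMass_le (f := g) (x := u) (y := f u) hu.1 (fun v hv h _ => ⟨hv.1, h.le⟩)
      simp only [hF]
      linarith)
    (fun u hu => by
      refine pow_le_pow_left₀ (cornerMass_nonneg _) ?_ 2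
      have a1 := graphMass_le (f := f) (x := u) (y := f u) hu.1 (fun v hv h h' => by
        refine ⟨?_, h.le⟩
        by_contra hv'
        rw [f2 hu.1, f1 (not_le.1 hv')] at h'
        linarith [hv.1, hu.2])
      have a2 := graphMass_le (f := g) (x := u) (y := f u) (s := 1 - u) (t := 1 / 2)
        (by linarith [hu.1]) (fun v hv h h' => by
        rw [f2 hu.1] at h'
        rcases lt_or_ge v (1 / 2) with hv' | hv'
        · rw [g1 hv'] at h'
          exact ⟨by linarith, hv'.le⟩
        · rw [g2 hv'] at h'
          linarith [hu.2])
      simp only [hF]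
      linarith)
  have i2 := integral_Ico_le_integral (F := fun u => cornerMass (segmentMeasure 1) (u, g u) ^ 2)
    (p := fun u => 0) (q := fun u => (1 / 2) ^ 2)
    (hm.comp (by fun_prop)) (fun u => abs_sq_cornerMass_le_one _) (by fun_prop) (by fun_prop)
    (fun u hu => by
      have a1 := graphMass_le (f := f) (x := u) (y := g u) (le_refl 0) (fun v hv h h' => by
        rw [f1 (h.trans hu.2), g1 hu.2] at h'
        linarith [hv.1, hu.1])
      have a2 := graphMass_le (f := g) (x := u) (y := g u) (le_refl 0) (fun v hv h h' => by
        rw [g1 (h.trans hu.2), g1 hu.2] at h'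
        linarith)
      have h0 := cornerMass_nonneg (μ := segmentMeasure 1) (u, g u)
      have : cornerMass (segmentMeasure 1) (u, g u) = 0 := by
        refine le_antisymm ?_ h0
        simp only [hF]
        linarith
      simp [this])
    (fun u hu => by
      refine pow_le_pow_left₀ (cornerMass_nonneg _) ?_ 2
      have a1 := graphMass_le_add (f := f) (x := u) (y := g u) (s := 0) (t := 1 - u)
        (by linarith [hu.2]) hu.1 (fun v hv h h' => by
        rw [g2 hu.1] at h'
        rcases lt_or_ge v (1 / 2) with hv' | hv'
        · rw [f1 hv'] at h'
          exact Or.inl ⟨hv.1, by linarith⟩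
        · exact Or.inr ⟨hv', h.le⟩)
      have a2 := graphMass_le (f := g) (x := u) (y := g u) (s := 0) (t := 1 / 2)
        (by norm_num) (fun v hv h h' => by
        refine ⟨hv.1, ?_⟩
        by_contra hv'
        rw [g2 hu.1, g2 (not_le.1 hv').le] at h'
        linarith)
      simp only [hF]
      linarith)
  have e1 : ∫ u in (0 : ℝ)..(1 / 2), u ^ 2 = 1 / 24 := by
    rw [integral_pow]; norm_num
  have e2 : ∫ u in (1 / 2 : ℝ)..1, (u - 1 / 2) ^ 2 = 1 / 24 := by
    rw [intervalIntegral.integral_comp_sub_right (fun u => u ^ 2) (1 / 2), integral_pow]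
    norm_num
  rw [hI]
  rw [e1, e2] at i1
  simp only [intervalIntegral.integral_const, smul_eq_mul] at i2
  norm_num at i1 i2 ⊢
  linarith

/-! ### Existence of `b` by the intermediate value theorem, and the conclusion -/

theorem exists_isSymmetricOfOrder_three :
    ∃ b ∈ Icc (0 : ℝ) 1, IsSymmetricOfOrder 3 (segmentMeasure b) := by
  have hc := continuousOn_real_pi_segmentMeasure measurableSet_cornerEvent
    isOrderInvariant_cornerEvent
  obtain ⟨b, hb, h⟩ := intermediate_value_Icc' zero_le_one hc
    ⟨real_cornerEvent_lt_one_ninth.le, one_ninth_lt_real_cornerEvent.le⟩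
  exact ⟨b, hb, isSymmetricOfOrder_three_of_real_cornerEvent hb h⟩

theorem ConvergesToMeasure.propertyP_iff {m : ℕ → ℕ} {τ : ∀ j, Equiv.Perm (Fin (m j))}
    {μ : Measure (ℝ × ℝ)} (h : ConvergesToMeasure m τ μ) (k : ℕ) :
    PropertyP k m τ ↔ IsSymmetricOfOrder k μ :=
  ⟨fun hP π => tendsto_nhds_unique (h.2 k π) (hP.2 π), fun hs => ⟨h.1, fun π => hs π ▸ h.2 k π⟩⟩

theorem mainTheorem4 :
    (∀ a ∈ Set.Icc (0 : ℝ) 1, HasUniformMarginals (segmentMeasure a)) ∧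
    ∃ b ∈ Set.Icc (0 : ℝ) 1,
      HasUniformMarginals (segmentMeasure b) ∧
      IsSymmetricOfOrder 3 (segmentMeasure b) ∧
      segmentMeasure b ≠ uniformSquare ∧
      ¬ IsSymmetricOfOrder 4 (segmentMeasure b) ∧
      (∃ (m : ℕ → ℕ) (τ : ∀ j, Equiv.Perm (Fin (m j))),
        ConvergesToMeasure m τ (segmentMeasure b)) ∧
      (∀ (m : ℕ → ℕ) (τ : ∀ j, Equiv.Perm (Fin (m j))),
        ConvergesToMeasure m τ (segmentMeasure b) → PropertyP 3 m τ ∧ ¬ PropertyP 4 m τ) := by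
  refine ⟨fun a ha => hasUniformMarginals_segmentMeasure ha, ?_⟩
  obtain ⟨b, hb, h3⟩ := exists_isSymmetricOfOrder_three
  have hU := hasUniformMarginals_segmentMeasure hb
  have hne := segmentMeasure_ne_uniformSquare hb
  have h4 : ¬ IsSymmetricOfOrder 4 (segmentMeasure b) := fun h4 =>
    hne (hU.eq_uniformSquare_of_isSymmetricOfOrder h4)
  exact ⟨b, hb, hU, h3, hne, h4, exists_convergesToMeasure_segmentMeasure hb,
    fun m τ h => ⟨(h.propertyP_iff 3).2 h3, fun hP => h4 ((h.propertyP_iff 4).1 hP)⟩⟩
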